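/- Let $n\ge 1$, $m\ge 1$ and $s>1/2$ be given ($m,s$ real). Let $a_m\in C^\infty(\mathbb R^n\setminus 0)$ be real-valued and positively homogeneous of order $m$, i.e. $a_m(\lambda\xi)=\lambda^m a_m(\xi)$ for all $\lambda>0$, $\xi\ne0$, and let $a$ be a real-valued function satisfying one of the following two conditions: (H) $a(\xi)=a_m(\xi)$ and $\nabla a_m(\xi)\neq 0$ for all $\xi\in\mathbb R^n\setminus0$; (L) $a\in C^\infty(\mathbb R^n)$, $\nabla a(\xi)\ne0$ for all $\xi\in\mathbb R^n$, $\nabla a_m(\xi)\neq0$ for all $\xi\in\mathbb R^n\setminus0$, and for every multi-index $\alpha$ there is a constant $C_\alpha$ such that $$|\partial^\alpha(a-a_m)(\xi)|\le C_\alpha|\xi|^{m-1-|\alpha|}\qquad\text{for all }|\xi|\ge1.$$ Then there is a constant $C>0$ such that for all $\varphi\in L^2(\mathbb R^n)$ $$\big\|\langle x\rangle^{-s}|D_x|^{(m-1)/2}e^{ita(D_x)}\varphi(x)\big\|_{L^2(\mathbb R_t\times\mathbb R^n_x)}\le C\|\varphi\|_{L^2(\mathbb R^n)}.$$ Here $\langle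 x\rangle=(1+|x|^2)^{1/2}$, $D_x=-i\partial_x$, and for each $t$ the expression $|D_x|^{(m-1)/2}e^{ita(D_x)}\varphi$ is the tempered distribution whose Fourier transform is $|\xi|^{(m-1)/2}e^{ita(\xi)}\widehat\varphi(\xi)$; the estimate includes the assertion that there is a measurable function on $\mathbb R_t\times\mathbb R^n_x$ which represents this distribution for almost every $t$. -/

import Mathlib

open MeasureTheory
open scoped ContDiff SchwartzMap FourierTransform ENNReal

/-- The principal term: a real-valued function that is smooth on `ℝⁿ \ 0` and positively
homogeneous of order `m` there (the value at the origin is irrelevant). -/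
structure IsPrincipalTerm {n : ℕ} (m : ℝ) (am : EuclideanSpace ℝ (Fin n) → ℝ) : Prop where
  smooth : ContDiffOn ℝ ∞ am {0}ᶜ
  homogeneous : ∀ (c : ℝ) (ξ : EuclideanSpace ℝ (Fin n)), 0 < c → ξ ≠ 0 →
    am (c • ξ) = c ^ m * am ξ

/-- The partial derivative `∂ f / ∂ ξ_i`. -/
noncomputable def partialDeriv {n : ℕ} (i : Fin n) (f : EuclideanSpace ℝ (Fin n) → ℝ) :
    EuclideanSpace ℝ (Fin n) → ℝ :=
  fun ξ => fderiv ℝ f ξ (EuclideanSpace.single i 1)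

/-- The derivative `∂^α f = ∂_1^{α_1} ⋯ ∂_n^{α_n} f` for a multi-index `α`. -/
noncomputable def multiIndexDeriv {n : ℕ} (α : Fin n → ℕ) (f : EuclideanSpace ℝ (Fin n) → ℝ) :
    EuclideanSpace ℝ (Fin n) → ℝ :=
  (List.finRange n).foldr (fun i g => (partialDeriv i)^[α i] g) f

/-- Condition (H): `a` equals its principal term, whose gradient does not vanish off the origin. -/
structure DispersiveH {n : ℕ} (a am : EuclideanSpace ℝ (Fin n) → ℝ) : Prop where
  eq_principal : ∀ ξ, ξ ≠ 0 → a ξ = am ξ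
  gradient_ne_zero : ∀ ξ, ξ ≠ 0 → gradient am ξ ≠ 0

/-- Condition (L): `a` is smooth on all of `ℝⁿ` with nowhere vanishing gradient, the gradient of
the principal term does not vanish off the origin, and `a` differs from the principal term by
a symbol of order `m - 1` on `|ξ| ≥ 1`. -/
structure DispersiveL {n : ℕ} (m : ℝ) (a am : EuclideanSpace ℝ (Fin n) → ℝ) : Prop where
  smooth : ContDiff ℝ ∞ a
  gradient_ne_zero : ∀ ξ, gradient a ξ ≠ 0
  gradient_principal_ne_zero : ∀ ξ, ξ ≠ 0 → gradient am ξ ≠ 0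
  lower_order : ∀ α : Fin n → ℕ, ∃ C : ℝ, ∀ ξ : EuclideanSpace ℝ (Fin n), 1 ≤ ‖ξ‖ →
    |multiIndexDeriv α (fun η => a η - am η) ξ| ≤ C * ‖ξ‖ ^ (m - 1 - ((∑ i, α i : ℕ) : ℝ))

/-- The symbol `|ξ|^{(m-1)/2} e^{i t a(ξ)}` of the operator `|D_x|^{(m-1)/2} e^{i t a(D_x)}`. -/
noncomputable def smoothingSymbol {n : ℕ} (m : ℝ) (a : EuclideanSpace ℝ (Fin n) → ℝ) (t : ℝ)
    (ξ : EuclideanSpace ℝ (Fin n)) : ℂ :=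
  ((‖ξ‖ ^ ((m - 1) / 2) : ℝ) : ℂ) * Complex.exp (Complex.I * t * a ξ)

/-- `v = σ(D_x) φ` for `φ ∈ L²(ℝⁿ)`: the tempered distribution `𝓕⁻¹[σ 𝓕 φ]` (which need not lie
in `L²` when `σ` is unbounded) is given by the function `v`, that is,
`∫ v ψ = ∫ σ (𝓕 φ) (𝓕⁻¹ ψ)` for all Schwartz functions `ψ`.
Here `D_x = -i ∂_x`; since Mathlib's Fourier transform has the kernel `e^{-2πi x·ξ}`,
the operator `D_x` is multiplication by `2πξ` on the Fourier side. -/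
def IsFourierMultiplierApplied {n : ℕ} (σ : EuclideanSpace ℝ (Fin n) → ℂ)
    (φ : Lp ℂ 2 (volume : Measure (EuclideanSpace ℝ (Fin n))))
    (v : EuclideanSpace ℝ (Fin n) → ℂ) : Prop :=
  ∀ ψ : 𝓢(EuclideanSpace ℝ (Fin n), ℂ),
    Integrable (fun x => v x * ψ x) ∧
    Integrable (fun ξ => σ ((2 * Real.pi) • ξ) * (𝓕 φ) ξ * (𝓕⁻ ψ) ξ) ∧
    ∫ x, v x * ψ x = ∫ ξ, σ ((2 * Real.pi) • ξ) * (𝓕 φ) ξ * (𝓕⁻ ψ) ξ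

/-- The Japanese bracket `⟨x⟩ = (1 + |x|²)^{1/2}`. -/
noncomputable def japaneseBracket {n : ℕ} (x : EuclideanSpace ℝ (Fin n)) : ℝ :=
  Real.sqrt (1 + ‖x‖ ^ 2)

/-! The smoothing comes from exchanging `t` with one space coordinate. Suppose the frequencies lie
in a convex open set on which `∂_e a ≥ c|ξ|^(m-1)` for a unit vector `e`. Replacing the
`e`-component of `ξ` by `a(ξ)` is then injective with Jacobian `∂_e a`. For a fixed value `r` of
`e·x`, the solution, as a function of `t` and the components of `x` orthogonal to `e`, is an inverse
Fourier transform in the new variables. By Plancherel its squared norm is at most the integral of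
`|ξ|^(m-1) |φ̂|² / ∂_e a`, up to the scaling by `2π`, hence at most `c⁻¹‖φ‖²` uniformly in `r`.
Since `⟨x⟩^(-s) ≤ ⟨e·x⟩^(-s)` and `s > 1/2`, the weight is square integrable in `r`, which gives the
estimate for that set (`lintegral_oscillatory_straighten_le`, `evolve_exchange`,
`IsTransversal.exists_eLpNorm_evolve_le`).

Finitely many such sets suffice. By homogeneity a nonzero gradient of the principal term gives a
lower bound on a whole cone, and the sphere of directions is compact; this settles (H). Under (L)
the lower-order part is absorbed far out in each cone, and the remaining ball is compact. The
estimates add up by splitting the data in frequency (`HasSmoothing.union`).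

The integral formula needs data with integrable weighted transform. General data are reached by
frequency truncation: the weighted solutions are Cauchy in `L²`, and their limit is identified on
almost every time slice (`HasSmoothing.exists_estimate`). -/

theorem eLpNorm_two_sq {α : Type*} [MeasurableSpace α] (μ : Measure α) (g : α → ℂ) :
    eLpNorm g 2 μ ^ 2 = ∫⁻ x, ‖g x‖ₑ ^ 2 ∂μ := by
  simpa using eLpNorm_nnreal_pow_eq_lintegral (f := g) (p := 2) (μ := μ) (by norm_num)

/-! ### Plancherel's theorem for the Fourier integral. -/

section Plancherel

variable {E : Type*} [NormedAddCommGroup E] [InnerProductSpace ℝ E] [FiniteDimensional ℝ E]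
  [MeasurableSpace E] [BorelSpace E]

/-- The inverse Fourier transform is symmetric for the bilinear `L²` pairing. -/
theorem integral_fourierInv_mul_eq {f g : E → ℂ} (hf : Integrable f) (hg : Integrable g) :
    ∫ x, 𝓕⁻ f x * g x = ∫ ξ, f ξ * 𝓕⁻ g ξ := by
  have h := VectorFourier.integral_fourierIntegral_smul_eq_flip (L := -innerₗ E)
    (μ := volume) (ν := volume) Real.continuous_fourierChar
      (continuous_inner (𝕜 := ℝ) (E := E)).neg hf hg
  have hflip : (-innerₗ E).flip = -innerₗ E := by
    ext x y; simp [real_inner_comm]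
  rw [hflip] at h
  simpa only [smul_eq_mul] using! h

/-- **Plancherel's theorem** for the integral formula on `L¹ ∩ L²`. -/
theorem eLpNorm_fourierInv_eq {f : E → ℂ} (hf : Integrable f) (hf2 : MemLp f 2) :
    eLpNorm (𝓕⁻ f) 2 = eLpNorm f 2 := by
  have hfc : Continuous (𝓕⁻ f) :=
    VectorFourier.fourierIntegral_continuous Real.continuous_fourierChar
      (continuous_inner (𝕜 := ℝ) (E := E)).neg hf
  set g : Lp ℂ 2 (volume : Measure E) := 𝓕⁻ hf2.toLp with hg
  -- The integral and the `L²` transform define the same tempered distribution, so they agree almost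
  -- everywhere.
  have hae : 𝓕⁻ f =ᵐ[volume] g := by
    refine ae_eq_of_integral_contDiff_smul_eq hfc.locallyIntegrable
      ((Lp.memLp g).locallyIntegrable (by norm_num)) fun ψ hψ hψc => ?_
    let Ψ : 𝓢(E, ℂ) := HasCompactSupport.toSchwartzMap (f := fun x => (ψ x : ℂ))
      (hψc.comp_left Complex.ofReal_zero) (Complex.ofRealCLM.contDiff.comp hψ)
    have hΨ : ∀ x, Ψ x = (ψ x : ℂ) := fun x => rfl
    have h1 := DFunLike.congr_fun (Lp.fourierInv_toTemperedDistribution_eq hf2.toLp) Ψ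
    rw [TemperedDistribution.fourierInv_apply, Lp.toTemperedDistribution_apply,
      Lp.toTemperedDistribution_apply] at h1
    have h2 := integral_fourierInv_mul_eq hf Ψ.integrable
    calc ∫ x, ψ x • 𝓕⁻ f x = ∫ x, 𝓕⁻ f x * Ψ x := by
          simp [hΨ, mul_comm]
      _ = ∫ ξ, f ξ * 𝓕⁻ (Ψ : E → ℂ) ξ := h2
      _ = ∫ ξ, (𝓕⁻ Ψ) ξ • hf2.toLp f ξ := by
          refine integral_congr_ae ?_
          filter_upwards [hf2.coeFn_toLp] with x hx
          rw [hx, SchwartzMap.fourierInv_coe, smul_eq_mul, mul_comm]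
      _ = ∫ x, Ψ x • g x := h1
      _ = ∫ x, ψ x • g x := by simp [hΨ]
  rw [eLpNorm_congr_ae hae]
  have hn : ‖g‖ = ‖hf2.toLp f‖ := by
    rw [← Lp.norm_fourier_eq g, hg, FourierTransform.fourier_fourierInv_eq]
  rw [← Lp.enorm_def, ← eLpNorm_congr_ae hf2.coeFn_toLp, ← Lp.enorm_def, ← ofReal_norm,
    ← ofReal_norm, hn]

end Plancherel

/-! ### Frequency variables in which the symbol is a coordinate. -/

section Straightening

variable {E : Type*} [NormedAddCommGroup E] [InnerProductSpace ℝ E]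

/-- The change of variables replacing the component of `ξ` in the direction `e` by `b ξ`. -/
noncomputable def straighten (b : E → ℝ) (e ξ : E) : E := ξ + (b ξ - inner ℝ e ξ) • e

theorem inner_straighten (b : E → ℝ) (e ξ y : E) :
    inner ℝ y (straighten b e ξ) = inner ℝ y ξ + (b ξ - inner ℝ e ξ) * inner ℝ y e := by
  simp [straighten, inner_add_right, inner_smul_right]

theorem inner_straighten_self (b : E → ℝ) {e : E} (he : ‖e‖ = 1) (ξ : E) :
    inner ℝ e (straighten b e ξ) = b ξ := by
  simp [inner_straighten, he]

/-- Two points with the same image have the same `b` and differ by a multiple of `e`. By convexity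
the segment between them stays in `K`, where `b` is strictly increasing along `e`. -/
theorem straighten_injOn {b : E → ℝ} {b' : E → E →L[ℝ] ℝ} {e : E} {K : Set E} (he : ‖e‖ = 1)
    (hK : Convex ℝ K) (hb : ∀ ξ ∈ K, HasFDerivAt b (b' ξ) ξ) (hpos : ∀ ξ ∈ K, 0 < b' ξ e) :
    Set.InjOn (straighten b e) K := by
  intro ξ hξ η hη h
  have hbeq : b ξ = b η := by
    rw [← inner_straighten_self b he ξ, h, inner_straighten_self b he η]
  set r : ℝ := inner ℝ e ξ - inner ℝ e η with hr
  have hξη : ξ = η + r • e := by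
    simp only [straighten, hbeq] at h
    have h' : ξ = η + (b η - inner ℝ e η) • e - (b η - inner ℝ e ξ) • e := by
      rw [← h]; abel
    rw [h', hr]; module
  set D : Set ℝ := (AffineMap.lineMap η (η + e) : ℝ →ᵃ[ℝ] E) ⁻¹' K with hD
  have hline : ∀ t : ℝ, (AffineMap.lineMap η (η + e) : ℝ →ᵃ[ℝ] E) t = η + t • e := by
    intro t; simp [AffineMap.lineMap_apply, add_comm]
  have hDc : Convex ℝ D := hK.affine_preimage _
  have hder : ∀ t ∈ D, HasDerivAt (fun t : ℝ => b (η + t • e)) (b' (η + t • e) e) t := by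
    intro t ht
    have h1 : HasDerivAt (fun t : ℝ => η + t • e) e t := by
      simpa using ((hasDerivAt_id t).smul_const e).const_add η
    have ht' : η + t • e ∈ K := by rw [← hline]; exact ht
    exact (hb _ ht').comp_hasDerivAt t h1
  have hmono : StrictMonoOn (fun t : ℝ => b (η + t • e)) D := by
    refine strictMonoOn_of_deriv_pos hDc
      (fun t ht => (hder t ht).continuousAt.continuousWithinAt) fun t ht => ?_
    have ht' := interior_subset ht
    rw [(hder t ht').deriv]
    exact hpos _ (by rw [← hline]; exact ht')
  have h0 : (0 : ℝ) ∈ D := by simpa [hD] using hη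
  have h1 : r ∈ D := by
    change _ ∈ K
    rw [hline, ← hξη]; exact hξ
  have hr0 : r = 0 := hmono.injOn h1 h0 (by simp [← hξη, hbeq])
  rw [hξη, hr0]; simp

theorem straighten_hasFDerivAt {b : E → ℝ} {b' : E →L[ℝ] ℝ} {ξ : E} (e : E)
    (hb : HasFDerivAt b b' ξ) :
    HasFDerivAt (straighten b e)
      (ContinuousLinearMap.id ℝ E + (b' - innerSL ℝ e).smulRight e) ξ :=
  (hasFDerivAt_id ξ).add ((hb.sub (innerSL ℝ e).hasFDerivAt).smul_const e)

theorem det_id_add_smulRight [FiniteDimensional ℝ E] (l : E →L[ℝ] ℝ) (e : E) :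
    (ContinuousLinearMap.id ℝ E + l.smulRight e).det = 1 + l e :=
  LinearMap.transvection.det (l : E →ₗ[ℝ] ℝ) e

variable [FiniteDimensional ℝ E] [MeasurableSpace E] [BorelSpace E]

/-- Plancherel's theorem in the variables straightened along `e`. -/
theorem lintegral_oscillatory_straighten_le {b : E → ℝ} {b' : E → E →L[ℝ] ℝ} {e : E} {K : Set E}
    (he : ‖e‖ = 1) (hK : Convex ℝ K) (hKm : MeasurableSet K)
    (hb : ∀ ξ ∈ K, HasFDerivAt b (b' ξ) ξ)
    (hpos : ∀ ξ ∈ K, 0 < b' ξ e) {k : E → ℂ} (hk : Integrable k) (hk0 : ∀ ξ ∉ K, k ξ = 0) :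
    ∫⁻ y, ‖∫ ξ, Complex.exp (2 * Real.pi * inner ℝ y (straighten b e ξ) * Complex.I) * k ξ‖ₑ ^ 2
      ≤ ∫⁻ ξ in K, ‖k ξ‖ₑ ^ 2 / ENNReal.ofReal (b' ξ e) := by
  set Φ := straighten b e with hΦ
  have hinj : Set.InjOn Φ K := straighten_injOn he hK hb hpos
  set Φ' : E → E →L[ℝ] E := fun ξ =>
    ContinuousLinearMap.id ℝ E + (b' ξ - innerSL ℝ e).smulRight e with hΦ'
  have hder : ∀ ξ ∈ K, HasFDerivWithinAt Φ (Φ' ξ) K ξ := fun ξ hξ =>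
    (straighten_hasFDerivAt e (hb ξ hξ)).hasFDerivWithinAt
  have hdet : ∀ ξ, (Φ' ξ).det = b' ξ e := by
    intro ξ
    rw [hΦ', det_id_add_smulRight]; simp [he]
  have himg : MeasurableSet (Φ '' K) := measurable_image_of_fderivWithin hKm hder hinj
  -- The density of `k` transported by `Φ`. Squaring gives two inverse Jacobians, one of which is
  -- cancelled when the integral is pulled back to `K`.
  set G : E → ℂ := fun η =>
    ((b' (Function.invFunOn Φ K η) e)⁻¹ : ℝ) • k (Function.invFunOn Φ K η) with hG
  set H : E → ℂ := (Φ '' K).indicator G with hH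
  have hGΦ : ∀ ξ ∈ K, G (Φ ξ) = ((b' ξ e)⁻¹ : ℝ) • k ξ := by
    intro ξ hξ
    simp only [hG]
    rw [hinj.leftInvOn_invFunOn hξ]
  have habs : ∀ ξ ∈ K, |(Φ' ξ).det| = b' ξ e := fun ξ hξ => by
    rw [hdet, abs_of_pos (hpos ξ hξ)]
  have hHint : Integrable H := by
    rw [hH, integrable_indicator_iff himg,
      integrableOn_image_iff_integrableOn_abs_det_fderiv_smul volume hKm hder hinj]
    refine (hk.integrableOn (s := K)).congr_fun (fun ξ hξ => ?_) hKm
    simp only [habs ξ hξ, hGΦ ξ hξ, smul_smul, mul_inv_cancel₀ (hpos ξ hξ).ne', one_smul]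
  have hHsq : ∫⁻ η, ‖H η‖ₑ ^ 2 = ∫⁻ ξ in K, ‖k ξ‖ₑ ^ 2 / ENNReal.ofReal (b' ξ e) := by
    have h1 : (fun η => ‖H η‖ₑ ^ 2) = (Φ '' K).indicator (fun η => ‖G η‖ₑ ^ 2) := by
      ext η
      by_cases hη : η ∈ Φ '' K <;> simp [hH, hη]
    rw [h1, lintegral_indicator himg,
      lintegral_image_eq_lintegral_abs_det_fderiv_mul volume hKm hder hinj]
    refine setLIntegral_congr_fun hKm fun ξ hξ => ?_
    have hp := hpos ξ hξ
    have hp0 : ENNReal.ofReal (b' ξ e) ≠ 0 := by simpa using hp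
    simp only [habs ξ hξ, hGΦ ξ hξ, enorm_smul, mul_pow]
    rw [Real.enorm_of_nonneg (inv_nonneg.2 hp.le), ENNReal.ofReal_inv_of_pos hp, ← mul_assoc,
      pow_two, ← mul_assoc, ENNReal.mul_inv_cancel hp0 ENNReal.ofReal_ne_top, one_mul, mul_comm,
      ENNReal.div_eq_inv_mul, mul_comm]
  have hfour : ∀ y,
      ∫ ξ, Complex.exp (2 * Real.pi * inner ℝ y (Φ ξ) * Complex.I) * k ξ = 𝓕⁻ H y := by
    intro y
    rw [Real.fourierInv_eq']
    have h1 : (fun v => Complex.exp (↑(2 * Real.pi * inner ℝ v y) * Complex.I) • H v)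
        = (Φ '' K).indicator
          (fun v => Complex.exp (↑(2 * Real.pi * inner ℝ v y) * Complex.I) • G v) := by
      ext η
      by_cases hη : η ∈ Φ '' K <;> simp [hH, hη]
    rw [h1, integral_indicator himg,
      integral_image_eq_integral_abs_det_fderiv_smul volume hKm hder hinj,
      ← setIntegral_eq_integral_of_forall_compl_eq_zero (s := K)
        (fun ξ hξ => by rw [hk0 ξ hξ, mul_zero])]
    refine setIntegral_congr_fun hKm fun ξ hξ => ?_
    have hp := (hpos ξ hξ).ne'
    simp only [habs ξ hξ, hGΦ ξ hξ, real_inner_comm y]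
    simp only [Complex.real_smul, smul_eq_mul]
    push_cast
    have hpc : ((b' ξ e : ℝ) : ℂ) ≠ 0 := by exact_mod_cast hp
    field_simp
  -- Plancherel needs `H` in `L²`; otherwise the right-hand side is infinite.
  by_cases htop : ∫⁻ η, ‖H η‖ₑ ^ 2 = ⊤
  · rw [← hHsq, htop]; exact le_top
  have hH2 : MemLp H 2 := by
    refine ⟨hHint.1, ?_⟩
    rw [← eLpNorm_two_sq] at htop
    exact lt_top_iff_ne_top.2 fun h => htop (by rw [h]; simp)
  simp only [hfour]
  rw [← eLpNorm_two_sq, eLpNorm_fourierInv_eq hHint hH2, eLpNorm_two_sq, hHsq]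

end Straightening

/-! ### Exchange of time with a space coordinate. -/

section Exchange

variable {E : Type*} [NormedAddCommGroup E] [InnerProductSpace ℝ E]

/-- The linear involution of `ℝ × E` exchanging time with the coordinate in the direction `e`. -/
noncomputable def exchange (e : E) : ℝ × E →ₗ[ℝ] ℝ × E :=
  (innerₗ E e ∘ₗ LinearMap.snd ℝ ℝ E).prod
    (LinearMap.snd ℝ ℝ E +
      (LinearMap.fst ℝ ℝ E - innerₗ E e ∘ₗ LinearMap.snd ℝ ℝ E).smulRight e)

theorem exchange_apply (e : E) (p : ℝ × E) :
    exchange e p = (inner ℝ e p.2, p.2 + (p.1 - inner ℝ e p.2) • e) := rfl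

theorem exchange_exchange {e : E} (he : ‖e‖ = 1) (p : ℝ × E) :
    exchange e (exchange e p) = p := by
  have h : inner ℝ e (p.2 + (p.1 - inner ℝ e p.2) • e) = p.1 := by
    simp [inner_add_right, inner_smul_right, he]
  refine Prod.ext ?_ ?_
  · rw [exchange_apply, exchange_apply]; exact h
  · rw [exchange_apply, exchange_apply]
    dsimp only
    rw [h]; module

variable [FiniteDimensional ℝ E] [MeasurableSpace E] [BorelSpace E]

/-- A linear involution has determinant `±1`. -/
theorem measurePreserving_exchange {e : E} (he : ‖e‖ = 1) :
    MeasurePreserving (exchange e) (volume : Measure (ℝ × E)) volume := by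
  have hsq : LinearMap.det (exchange e) * LinearMap.det (exchange e) = 1 := by
    rw [← LinearMap.det_comp]
    have : exchange e ∘ₗ exchange e = LinearMap.id :=
      LinearMap.ext fun p => exchange_exchange he p
    rw [this, LinearMap.det_id]
  have hne : LinearMap.det (exchange e) ≠ 0 := fun h => by simp [h] at hsq
  have habs : |(LinearMap.det (exchange e))⁻¹| = 1 := by
    rcases mul_self_eq_one_iff.1 hsq with h | h <;> simp [h]
  refine ⟨(exchange e).continuous_of_finiteDimensional.measurable, ?_⟩
  have : (volume : Measure (ℝ × E)).IsAddHaarMeasure :=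
    inferInstanceAs (Measure.IsAddHaarMeasure ((volume : Measure ℝ).prod (volume : Measure E)))
  rw [Measure.map_linearMap_addHaar_eq_smul_addHaar volume hne, habs]
  simp

theorem lintegral_comp_exchange {e : E} (he : ‖e‖ = 1) (g : ℝ × E → ℝ≥0∞) :
    ∫⁻ p, g (exchange e p) = ∫⁻ p, g p := by
  have hm := measurePreserving_exchange he
  let φ : (ℝ × E) ≃ᵐ (ℝ × E) :=
    { toFun := exchange e
      invFun := exchange e
      left_inv := exchange_exchange he
      right_inv := exchange_exchange he
      measurable_toFun := hm.measurable
      measurable_invFun := hm.measurable }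
  exact hm.lintegral_comp_emb φ.measurableEmbedding g

end Exchange

/-! ### The estimate on one transversal frequency region. -/

section Piece

variable {n : ℕ}

theorem japaneseBracket_pos (x : EuclideanSpace ℝ (Fin n)) : 0 < japaneseBracket x :=
  Real.sqrt_pos.2 (by positivity)

theorem measurable_japaneseBracket :
    Measurable (japaneseBracket : EuclideanSpace ℝ (Fin n) → ℝ) := by
  unfold japaneseBracket
  fun_prop

theorem japaneseBracket_rpow_neg_sq_le {s : ℝ} (hs : 0 ≤ s) {e : EuclideanSpace ℝ (Fin n)}
    (he : ‖e‖ = 1) (x : EuclideanSpace ℝ (Fin n)) :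
    (japaneseBracket x ^ (-s)) ^ 2 ≤ (1 + ‖inner ℝ e x‖ ^ 2) ^ (-(2 * s) / 2) := by
  have h1 : (japaneseBracket x ^ (-s)) ^ 2 = (1 + ‖x‖ ^ 2) ^ (-(2 * s) / 2) := by
    rw [japaneseBracket, Real.sqrt_eq_rpow, ← Real.rpow_mul (by positivity), ← Real.rpow_natCast,
      ← Real.rpow_mul (by positivity)]
    congr 1; push_cast; ring
  rw [h1]
  refine Real.rpow_le_rpow_of_nonpos (by positivity) ?_ (by linarith)
  have := norm_inner_le_norm (𝕜 := ℝ) e x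
  rw [he, one_mul] at this
  gcongr

/-- The function `|D|^{(m-1)/2} e^{i t a(D)} φ` at `(t, x)`, as an integral over the Fourier
transform `f` of `φ`. -/
noncomputable def evolve (m : ℝ) (a : EuclideanSpace ℝ (Fin n) → ℝ)
    (f : EuclideanSpace ℝ (Fin n) → ℂ) (p : ℝ × EuclideanSpace ℝ (Fin n)) : ℂ :=
  𝓕⁻ (fun ξ => smoothingSymbol m a p.1 ((2 * Real.pi) • ξ) * f ξ) p.2

/-- At the exchanged point the time is `e·y` and the `e`-component of position is `r`. Collecting
the phase by powers of `e·y` leaves `y` paired with the straightened frequency and a unimodular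
factor depending on `r`. The `2π` in `b` matches the normalisation of `𝓕`. -/
theorem evolve_exchange (m : ℝ) (a : EuclideanSpace ℝ (Fin n) → ℝ)
    (f : EuclideanSpace ℝ (Fin n) → ℂ) (e y : EuclideanSpace ℝ (Fin n)) (r : ℝ) :
    evolve m a f (exchange e (r, y)) =
      ∫ ξ, Complex.exp (2 * Real.pi * inner ℝ y
          (straighten (fun ξ => (2 * Real.pi)⁻¹ * a ((2 * Real.pi) • ξ)) e ξ) * Complex.I) *
        (Complex.exp (2 * Real.pi * (r * inner ℝ e ξ) * Complex.I) *
          (((‖(2 * Real.pi) • ξ‖ ^ ((m - 1) / 2) : ℝ) : ℂ) * f ξ)) := by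
  rw [evolve, Real.fourierInv_eq', exchange_apply]
  refine integral_congr_ae (Filter.Eventually.of_forall fun ξ => ?_)
  simp only [smul_eq_mul, smoothingSymbol, inner_straighten]
  have hexp : Complex.exp (↑(2 * Real.pi * inner ℝ ξ (y + (r - inner ℝ e y) • e)) * Complex.I) *
      Complex.exp (Complex.I * (inner ℝ e y : ℝ) * a ((2 * Real.pi) • ξ)) =
      Complex.exp (2 * Real.pi * ((inner ℝ y ξ +
        ((2 * Real.pi)⁻¹ * a ((2 * Real.pi) • ξ) - inner ℝ e ξ) * inner ℝ y e : ℝ) : ℂ)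
          * Complex.I) *
      Complex.exp (2 * Real.pi * (r * (inner ℝ e ξ : ℝ)) * Complex.I) := by
    rw [← Complex.exp_add, ← Complex.exp_add, inner_add_right, inner_smul_right,
      real_inner_comm y ξ, real_inner_comm e ξ, real_inner_comm e y]
    congr 1
    push_cast
    have : (Real.pi : ℂ) ≠ 0 := by exact_mod_cast Real.pi_ne_zero
    field_simp
    ring
  linear_combination (((‖(2 * Real.pi) • ξ‖ ^ ((m - 1) / 2) : ℝ) : ℂ) * f ξ) * hexp

/-- A convex region of frequencies on which `a` is increasing along `e`, with a lower bound for the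
directional derivative of the order of the principal term. -/
structure IsTransversal (m : ℝ) (a : EuclideanSpace ℝ (Fin n) → ℝ)
    (K : Set (EuclideanSpace ℝ (Fin n))) (e : EuclideanSpace ℝ (Fin n)) (c : ℝ) : Prop where
  isOpen : IsOpen K
  convex : Convex ℝ K
  norm_eq_one : ‖e‖ = 1
  differentiableAt : ∀ ξ ∈ K, DifferentiableAt ℝ a ξ
  fderiv_pos : ∀ ξ ∈ K, 0 < fderiv ℝ a ξ e
  pos : 0 < c
  le_fderiv : ∀ ξ ∈ K, c * ‖ξ‖ ^ (m - 1) ≤ fderiv ℝ a ξ e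

/-- The multiplier contributes `|2πξ|^(m-1)` to the square and the Jacobian divides by `∂_e a(2πξ)`;
transversality bounds the quotient by `c⁻¹`. The factor depending on `r` has modulus one, hence
uniformity in `r`. -/
theorem IsTransversal.lintegral_evolve_exchange_le {m : ℝ} {a : EuclideanSpace ℝ (Fin n) → ℝ}
    {K : Set (EuclideanSpace ℝ (Fin n))} {e : EuclideanSpace ℝ (Fin n)} {c : ℝ}
    (hK : IsTransversal m a K e c) {f : EuclideanSpace ℝ (Fin n) → ℂ}
    (hf : Integrable (fun ξ => ((‖(2 * Real.pi) • ξ‖ ^ ((m - 1) / 2) : ℝ) : ℂ) * f ξ))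
    (hf0 : ∀ ξ, (2 * Real.pi) • ξ ∉ K → f ξ = 0) (r : ℝ) :
    ∫⁻ y, ‖evolve m a f (exchange e (r, y))‖ₑ ^ 2 ≤
      ENNReal.ofReal c⁻¹ * ∫⁻ ξ, ‖f ξ‖ₑ ^ 2 := by
  set K' : Set (EuclideanSpace ℝ (Fin n)) := (fun ξ => (2 * Real.pi) • ξ) ⁻¹' K with hK'
  have hK'm : MeasurableSet K' := (hK.isOpen.preimage (by fun_prop)).measurableSet
  have hK'c : Convex ℝ K' := by
    have := hK.convex.linear_preimage ((2 * Real.pi) • LinearMap.id)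
    exact this
  have hder : ∀ ξ ∈ K', HasFDerivAt (fun ξ => (2 * Real.pi)⁻¹ * a ((2 * Real.pi) • ξ))
      (fderiv ℝ a ((2 * Real.pi) • ξ)) ξ := by
    intro ξ hξ
    have h1 : HasFDerivAt (fun ξ : EuclideanSpace ℝ (Fin n) => (2 * Real.pi) • ξ)
        ((2 * Real.pi) • ContinuousLinearMap.id ℝ _) ξ :=
      ((2 * Real.pi) • ContinuousLinearMap.id ℝ (EuclideanSpace ℝ (Fin n))).hasFDerivAt
    have h2 := ((hK.differentiableAt _ hξ).hasFDerivAt.comp ξ h1).const_mul (2 * Real.pi)⁻¹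
    convert! h2 using 1
    ext v
    simp
    field_simp
  have hk : Integrable (fun ξ => Complex.exp (2 * Real.pi * (r * inner ℝ e ξ) * Complex.I) *
          (((‖(2 * Real.pi) • ξ‖ ^ ((m - 1) / 2) : ℝ) : ℂ) * f ξ)) := by
    refine hf.bdd_mul (c := 1) (Continuous.aestronglyMeasurable (by fun_prop))
      (Filter.Eventually.of_forall fun ξ => ?_)
    have := Complex.norm_exp_ofReal_mul_I (2 * Real.pi * (r * inner ℝ e ξ))
    push_cast at this
    exact this.le
  simp only [evolve_exchange]
  refine (lintegral_oscillatory_straighten_le hK.norm_eq_one hK'c hK'm hder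
    (fun ξ hξ => hK.fderiv_pos _ hξ) hk (fun ξ hξ => by rw [hf0 ξ hξ]; simp)).trans ?_
  rw [← lintegral_const_mul' _ _ ENNReal.ofReal_ne_top]
  refine (setLIntegral_mono' (g := fun ξ => ENNReal.ofReal c⁻¹ * ‖f ξ‖ₑ ^ 2) hK'm
    fun ξ hξ => ?_).trans (setLIntegral_le_lintegral _ _)
  set D := fderiv ℝ a ((2 * Real.pi) • ξ) e with hD
  have hDpos : 0 < D := hK.fderiv_pos _ hξ
  have hDle : c * ‖(2 * Real.pi) • ξ‖ ^ (m - 1) ≤ D := hK.le_fderiv _ hξ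
  have hexp : ‖Complex.exp (2 * Real.pi * (r * inner ℝ e ξ) * Complex.I)‖ₑ = 1 := by
    have := Complex.norm_exp_ofReal_mul_I (2 * Real.pi * (r * inner ℝ e ξ))
    push_cast at this
    rw [← ofReal_norm, this, ENNReal.ofReal_one]
  rw [enorm_mul, enorm_mul, hexp, one_mul, mul_pow, ← ofReal_norm (((_ : ℝ) : ℂ)),
    Complex.norm_real, Real.norm_of_nonneg (by positivity), ← ENNReal.ofReal_pow (by positivity),
    ← Real.rpow_natCast, ← Real.rpow_mul (by positivity), ENNReal.mul_div_right_comm,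
    ← ENNReal.ofReal_div_of_pos hDpos]
  gcongr
  rw [div_le_iff₀ hDpos, ← div_eq_inv_mul, le_div_iff₀ hK.pos, mul_comm]
  convert! hDle using 3
  push_cast; ring

theorem IsTransversal.exists_eLpNorm_evolve_le {m s : ℝ} (hs : 1 / 2 < s)
    {a : EuclideanSpace ℝ (Fin n) → ℝ}
    {K : Set (EuclideanSpace ℝ (Fin n))} {e : EuclideanSpace ℝ (Fin n)} {c : ℝ}
    (hK : IsTransversal m a K e c) : ∃ C : NNReal, ∀ f : EuclideanSpace ℝ (Fin n) → ℂ,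
      Integrable (fun ξ => ((‖(2 * Real.pi) • ξ‖ ^ ((m - 1) / 2) : ℝ) : ℂ) * f ξ) →
      (∀ ξ, (2 * Real.pi) • ξ ∉ K → f ξ = 0) →
      eLpNorm (fun p : ℝ × EuclideanSpace ℝ (Fin n) =>
        ((japaneseBracket p.2 ^ (-s) : ℝ) : ℂ) * evolve m a f p) 2 volume ≤
        C * eLpNorm f 2 volume := by
  set I : ℝ≥0∞ := ∫⁻ r : ℝ, ENNReal.ofReal ((1 + ‖r‖ ^ 2) ^ (-(2 * s) / 2)) with hI
  have hIfin : I ≠ ⊤ := by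
    have h := integrable_rpow_neg_one_add_norm_sq (E := ℝ) (μ := volume) (r := 2 * s)
      (by simp; linarith)
    exact h.lintegral_lt_top.ne
  -- `I` is finite because `2 * s > 1`, the dimension of the line.
  set A : NNReal := (I * ENNReal.ofReal c⁻¹).toNNReal with hA
  have hAeq : (A : ℝ≥0∞) = I * ENNReal.ofReal c⁻¹ :=
    ENNReal.coe_toNNReal (ENNReal.mul_ne_top hIfin ENNReal.ofReal_ne_top)
  refine ⟨NNReal.sqrt A, fun f hf hf0 => ?_⟩
  rw [← ENNReal.pow_le_pow_left_iff two_ne_zero, mul_pow, eLpNorm_two_sq, eLpNorm_two_sq,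
    ← ENNReal.coe_pow, NNReal.sq_sqrt, hAeq]
  calc ∫⁻ p : ℝ × EuclideanSpace ℝ (Fin n),
        ‖((japaneseBracket p.2 ^ (-s) : ℝ) : ℂ) * evolve m a f p‖ₑ ^ 2
      ≤ ∫⁻ p : ℝ × EuclideanSpace ℝ (Fin n),
        ENNReal.ofReal ((1 + ‖inner ℝ e p.2‖ ^ 2) ^ (-(2 * s) / 2)) * ‖evolve m a f p‖ₑ ^ 2 := by
        refine lintegral_mono fun p => ?_
        rw [enorm_mul, mul_pow, ← ofReal_norm (((_ : ℝ) : ℂ)), Complex.norm_real,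
          Real.norm_of_nonneg (Real.rpow_nonneg (japaneseBracket_pos _).le _),
          ← ENNReal.ofReal_pow (Real.rpow_nonneg (japaneseBracket_pos _).le _)]
        gcongr
        exact japaneseBracket_rpow_neg_sq_le (by linarith) hK.norm_eq_one _
    _ = ∫⁻ p : ℝ × EuclideanSpace ℝ (Fin n),
        ENNReal.ofReal ((1 + ‖p.1‖ ^ 2) ^ (-(2 * s) / 2)) *
          ‖evolve m a f (exchange e p)‖ₑ ^ 2 := by
        -- As `exchange e` is an involution, the `e`-component of the exchanged point is `p.1`, so
        -- the weight depends on the first variable only.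
        rw [← lintegral_comp_exchange hK.norm_eq_one]
        refine lintegral_congr fun p => ?_
        congr 5
        exact congrArg (fun q => ‖Prod.fst q‖) (exchange_exchange hK.norm_eq_one p)
    -- This direction of Tonelli requires no measurability.
    _ ≤ ∫⁻ r : ℝ, ∫⁻ y, ENNReal.ofReal ((1 + ‖r‖ ^ 2) ^ (-(2 * s) / 2)) *
          ‖evolve m a f (exchange e (r, y))‖ₑ ^ 2 := lintegral_prod_le _
    _ ≤ ∫⁻ r : ℝ, ENNReal.ofReal ((1 + ‖r‖ ^ 2) ^ (-(2 * s) / 2)) *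
          (ENNReal.ofReal c⁻¹ * ∫⁻ ξ, ‖f ξ‖ₑ ^ 2) := by
        refine lintegral_mono fun r => ?_
        rw [lintegral_const_mul' _ _ ENNReal.ofReal_ne_top]
        gcongr
        exact hK.lintegral_evolve_exchange_le hf hf0 r
    _ = I * ENNReal.ofReal c⁻¹ * ∫⁻ ξ, ‖f ξ‖ₑ ^ 2 := by
        rw [lintegral_mul_const, mul_assoc]
        fun_prop

end Piece

/-! ### Gluing estimates over frequency sets. -/

section Superposition

variable {n : ℕ}

theorem norm_exp_I_mul_mul (t b : ℝ) : ‖Complex.exp (Complex.I * t * b)‖ = 1 := by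
  rw [show Complex.I * t * b = ((t * b : ℝ) : ℂ) * Complex.I by push_cast; ring]
  exact Complex.norm_exp_ofReal_mul_I _

theorem integrable_smoothingSymbol_mul {m : ℝ} {a : EuclideanSpace ℝ (Fin n) → ℝ}
    (ha : Measurable a) {f : EuclideanSpace ℝ (Fin n) → ℂ}
    (hf : Integrable (fun ξ => ((‖(2 * Real.pi) • ξ‖ ^ ((m - 1) / 2) : ℝ) : ℂ) * f ξ)) (t : ℝ) :
    Integrable (fun ξ => smoothingSymbol m a t ((2 * Real.pi) • ξ) * f ξ) := by
  have hm : Measurable fun ξ : EuclideanSpace ℝ (Fin n) =>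
      Complex.exp (Complex.I * t * a ((2 * Real.pi) • ξ)) := by fun_prop
  refine (hf.bdd_mul (c := 1) hm.aestronglyMeasurable
    (Filter.Eventually.of_forall fun ξ => (norm_exp_I_mul_mul _ _).le)).congr
    (Filter.Eventually.of_forall fun ξ => ?_)
  simp only [smoothingSymbol]; ring

theorem aestronglyMeasurable_evolve {m : ℝ} {a : EuclideanSpace ℝ (Fin n) → ℝ}
    (ha : Measurable a) {f : EuclideanSpace ℝ (Fin n) → ℂ}
    (hf : AEStronglyMeasurable f) :
    AEStronglyMeasurable (evolve m a f) volume := by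
  have h : AEStronglyMeasurable (fun q : (ℝ × EuclideanSpace ℝ (Fin n)) ×
      EuclideanSpace ℝ (Fin n) =>
      Complex.exp (↑(2 * Real.pi * inner ℝ q.2 q.1.2) * Complex.I) •
        (smoothingSymbol m a q.1.1 ((2 * Real.pi) • q.2) * f q.2)) (volume.prod volume) := by
    have h1 : Measurable fun q : (ℝ × EuclideanSpace ℝ (Fin n)) × EuclideanSpace ℝ (Fin n) =>
        Complex.exp (↑(2 * Real.pi * inner ℝ q.2 q.1.2) * Complex.I) := by fun_prop
    have h2 : Measurable fun q : (ℝ × EuclideanSpace ℝ (Fin n)) × EuclideanSpace ℝ (Fin n) =>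
        smoothingSymbol m a q.1.1 ((2 * Real.pi) • q.2) := by
      unfold smoothingSymbol; fun_prop
    exact h1.aestronglyMeasurable.smul (h2.aestronglyMeasurable.mul hf.comp_snd)
  have h3 := h.integral_prod_right'
  refine h3.congr (Filter.Eventually.of_forall fun p => ?_)
  rw [evolve, Real.fourierInv_eq']

theorem evolve_add {m : ℝ} {a : EuclideanSpace ℝ (Fin n) → ℝ} (ha : Measurable a)
    {f g : EuclideanSpace ℝ (Fin n) → ℂ}
    (hf : Integrable (fun ξ => ((‖(2 * Real.pi) • ξ‖ ^ ((m - 1) / 2) : ℝ) : ℂ) * f ξ))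
    (hg : Integrable (fun ξ => ((‖(2 * Real.pi) • ξ‖ ^ ((m - 1) / 2) : ℝ) : ℂ) * g ξ))
    (p : ℝ × EuclideanSpace ℝ (Fin n)) :
    evolve m a (f + g) p = evolve m a f p + evolve m a g p := by
  simp only [evolve, Real.fourierInv_eq, Pi.add_apply, mul_add, smul_add]
  refine integral_add ?_ ?_
  · exact (Real.fourierIntegral_convergent_iff (-p.2)).2
      (integrable_smoothingSymbol_mul ha hf p.1) |>.congr
      (Filter.Eventually.of_forall fun ξ => by simp)
  · exact (Real.fourierIntegral_convergent_iff (-p.2)).2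
      (integrable_smoothingSymbol_mul ha hg p.1) |>.congr
      (Filter.Eventually.of_forall fun ξ => by simp)

theorem evolve_sub {m : ℝ} {a : EuclideanSpace ℝ (Fin n) → ℝ} (ha : Measurable a)
    {f g : EuclideanSpace ℝ (Fin n) → ℂ}
    (hf : Integrable (fun ξ => ((‖(2 * Real.pi) • ξ‖ ^ ((m - 1) / 2) : ℝ) : ℂ) * f ξ))
    (hg : Integrable (fun ξ => ((‖(2 * Real.pi) • ξ‖ ^ ((m - 1) / 2) : ℝ) : ℂ) * g ξ))
    (p : ℝ × EuclideanSpace ℝ (Fin n)) :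
    evolve m a (f - g) p = evolve m a f p - evolve m a g p := by
  have hfg : Integrable
      (fun ξ => ((‖(2 * Real.pi) • ξ‖ ^ ((m - 1) / 2) : ℝ) : ℂ) * (f - g) ξ) := by
    simpa only [Pi.sub_apply, mul_sub] using! hf.sub hg
  rw [eq_sub_iff_add_eq, ← evolve_add ha hfg hg, sub_add_cancel]

/-- The weighted space-time estimate for data with frequencies in a measurable set
containing `S`. -/
def HasSmoothing (m s : ℝ) (a : EuclideanSpace ℝ (Fin n) → ℝ)
    (S : Set (EuclideanSpace ℝ (Fin n))) : Prop :=
  ∃ S', S ⊆ S' ∧ MeasurableSet S' ∧ ∃ C : NNReal, ∀ f : EuclideanSpace ℝ (Fin n) → ℂ,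
    AEStronglyMeasurable f →
    Integrable (fun ξ => ((‖(2 * Real.pi) • ξ‖ ^ ((m - 1) / 2) : ℝ) : ℂ) * f ξ) →
    (∀ ξ, (2 * Real.pi) • ξ ∉ S' → f ξ = 0) →
    eLpNorm (fun p : ℝ × EuclideanSpace ℝ (Fin n) =>
      ((japaneseBracket p.2 ^ (-s) : ℝ) : ℂ) * evolve m a f p) 2 volume ≤
      C * eLpNorm f 2 volume

variable {m s : ℝ} {a : EuclideanSpace ℝ (Fin n) → ℝ} {S T : Set (EuclideanSpace ℝ (Fin n))}

theorem IsTransversal.hasSmoothing (hs : 1 / 2 < s) {e : EuclideanSpace ℝ (Fin n)} {c : ℝ}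
    (hS : IsTransversal m a S e c) : HasSmoothing m s a S := by
  obtain ⟨C, hC⟩ := hS.exists_eLpNorm_evolve_le hs
  exact ⟨S, subset_rfl, hS.isOpen.measurableSet, C, fun f _ => hC f⟩

/-- The measurable enlargement in `HasSmoothing` allows arbitrary subsets here, as compactness
induction requires. -/
theorem HasSmoothing.mono (hST : S ⊆ T) (hT : HasSmoothing m s a T) : HasSmoothing m s a S := by
  obtain ⟨T', h, h'⟩ := hT
  exact ⟨T', hST.trans h, h'⟩

theorem hasSmoothing_empty : HasSmoothing m s a ∅ := by
  refine ⟨∅, subset_rfl, MeasurableSet.empty, 0, fun f _ _ hf => ?_⟩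
  have hf0 : f = 0 := funext fun ξ => hf ξ (Set.notMem_empty _)
  have : (fun p : ℝ × EuclideanSpace ℝ (Fin n) =>
      ((japaneseBracket p.2 ^ (-s) : ℝ) : ℂ) * evolve m a f p) = 0 := by
    ext p
    simp [hf0, evolve, Real.fourierInv_eq']
  rw [this]; simp

theorem aestronglyMeasurable_weight_mul_evolve (ha : Measurable a)
    {f : EuclideanSpace ℝ (Fin n) → ℂ} (hf : AEStronglyMeasurable f) :
    AEStronglyMeasurable (fun p : ℝ × EuclideanSpace ℝ (Fin n) =>
      ((japaneseBracket p.2 ^ (-s) : ℝ) : ℂ) * evolve m a f p) volume := by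
  refine AEStronglyMeasurable.mul ?_ (aestronglyMeasurable_evolve ha hf)
  have := measurable_japaneseBracket (n := n)
  exact Measurable.aestronglyMeasurable (by fun_prop)

/-- The data split into the part with frequencies in `S'` and the rest, which lives in `T'`; neither
indicator increases the `L²` norm. -/
theorem HasSmoothing.union (ha : Measurable a) (hS : HasSmoothing m s a S)
    (hT : HasSmoothing m s a T) : HasSmoothing m s a (S ∪ T) := by
  obtain ⟨S', hSS', hSm, C, hC⟩ := hS
  obtain ⟨T', hTT', hTm, D, hD⟩ := hT
  refine ⟨S' ∪ T', Set.union_subset_union hSS' hTT', hSm.union hTm, C + D, fun f hfm hf hf0 => ?_⟩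
  set A : Set (EuclideanSpace ℝ (Fin n)) := (fun ξ => (2 * Real.pi) • ξ) ⁻¹' S' with hA
  have hAm : MeasurableSet A := hSm.preimage (by fun_prop)
  have hintg : ∀ B : Set (EuclideanSpace ℝ (Fin n)), MeasurableSet B →
      Integrable (fun ξ => ((‖(2 * Real.pi) • ξ‖ ^ ((m - 1) / 2) : ℝ) : ℂ) * B.indicator f ξ) := by
    intro B hB
    refine (hf.indicator hB).congr (Filter.Eventually.of_forall fun ξ => ?_)
    by_cases h : ξ ∈ B <;> simp [h]
  have hsum : A.indicator f + Aᶜ.indicator f = f := Set.indicator_self_add_compl A f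
  have h1 := hC (A.indicator f) (hfm.indicator hAm) (hintg A hAm) (fun ξ hξ =>
    Set.indicator_of_notMem (by exact hξ) f)
  have h2 := hD (Aᶜ.indicator f) (hfm.indicator hAm.compl) (hintg _ hAm.compl) (fun ξ hξ => by
    by_cases h : ξ ∈ A
    · simp [h]
    · rw [Set.indicator_of_mem (by exact h)]
      exact hf0 ξ (fun h' => h'.elim h hξ))
  have hadd : (fun p : ℝ × EuclideanSpace ℝ (Fin n) =>
      ((japaneseBracket p.2 ^ (-s) : ℝ) : ℂ) * evolve m a f p) =
      (fun p => ((japaneseBracket p.2 ^ (-s) : ℝ) : ℂ) * evolve m a (A.indicator f) p) +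
      (fun p => ((japaneseBracket p.2 ^ (-s) : ℝ) : ℂ) * evolve m a (Aᶜ.indicator f) p) := by
    ext p
    conv_lhs => rw [← hsum, evolve_add ha (hintg A hAm) (hintg _ hAm.compl)]
    simp only [Pi.add_apply, mul_add]
  rw [hadd]
  refine (eLpNorm_add_le (aestronglyMeasurable_weight_mul_evolve ha (hfm.indicator hAm))
    (aestronglyMeasurable_weight_mul_evolve ha (hfm.indicator hAm.compl)) (by norm_num)).trans ?_
  rw [ENNReal.coe_add, add_mul]
  gcongr
  · exact h1.trans (by gcongr; exact eLpNorm_indicator_le f)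
  · exact h2.trans (by gcongr; exact eLpNorm_indicator_le f)

end Superposition

/-! ### Truncated cones. -/

section Cones

variable {E : Type*} [NormedAddCommGroup E] [InnerProductSpace ℝ E]

/-- The cone over the ball of radius `ε` around `θ`, truncated at height `R`. -/
def truncatedCone (θ : E) (ε R : ℝ) : Set E := {ξ | ∃ r, R < r ∧ ‖ξ - r • θ‖ < ε * r}

theorem isOpen_truncatedCone (θ : E) (ε R : ℝ) : IsOpen (truncatedCone θ ε R) := by
  have : truncatedCone θ ε R = ⋃ r ∈ Set.Ioi R, {ξ | ‖ξ - r • θ‖ < ε * r} := by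
    ext ξ; simp [truncatedCone]
  rw [this]
  exact isOpen_biUnion fun r _ => isOpen_lt (by fun_prop) (by fun_prop)

theorem convex_truncatedCone (θ : E) (ε R : ℝ) : Convex ℝ (truncatedCone θ ε R) := by
  refine convex_iff_forall_pos.2 ?_
  rintro ξ ⟨r, hr, hξ⟩ η ⟨t, ht, hη⟩ x y hx hy hxy
  refine ⟨x * r + y * t, ?_, ?_⟩
  · calc R = x * R + y * R := by rw [← add_mul, hxy, one_mul]
      _ < _ := by gcongr
  · calc ‖x • ξ + y • η - (x * r + y * t) • θ‖ = ‖x • (ξ - r • θ) + y • (η - t • θ)‖ := by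
          congr 1; module
      _ ≤ x * ‖ξ - r • θ‖ + y * ‖η - t • θ‖ := by
          refine (norm_add_le _ _).trans ?_
          rw [norm_smul, norm_smul, Real.norm_of_nonneg hx.le, Real.norm_of_nonneg hy.le]
      _ < x * (ε * r) + y * (ε * t) := by gcongr
      _ = ε * (x * r + y * t) := by ring

/-- A point of a truncated cone is a multiple of a point near the axis. -/
theorem exists_smul_of_mem_truncatedCone {θ ξ : E} {ε R : ℝ} (hR : 0 ≤ R)
    (hξ : ξ ∈ truncatedCone θ ε R) : ∃ r ζ, R < r ∧ ‖ζ - θ‖ < ε ∧ ξ = r • ζ := by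
  obtain ⟨r, hr, h⟩ := hξ
  have hr0 : 0 < r := hR.trans_lt hr
  refine ⟨r, r⁻¹ • ξ, hr, ?_, by rw [smul_smul, mul_inv_cancel₀ hr0.ne', one_smul]⟩
  have : r⁻¹ • ξ - θ = r⁻¹ • (ξ - r • θ) := by
    rw [smul_sub, smul_smul, inv_mul_cancel₀ hr0.ne', one_smul]
  rw [this, norm_smul, norm_inv, Real.norm_of_nonneg hr0.le, inv_mul_lt_iff₀ hr0, mul_comm]
  exact h

theorem smul_mem_truncatedCone {θ ζ : E} {ε R r : ℝ} (hR : 0 ≤ R) (hr : R < r)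
    (hζ : ‖ζ - θ‖ < ε) : r • ζ ∈ truncatedCone θ ε R := by
  have hr0 : 0 < r := hR.trans_lt hr
  refine ⟨r, hr, ?_⟩
  rw [← smul_sub, norm_smul, Real.norm_of_nonneg hr0.le, mul_comm]
  gcongr

end Cones

/-! ### Lower bounds for directional derivatives. -/

section Derivatives

variable {n : ℕ}

theorem fderiv_eq_inner_gradient {E : Type*} [NormedAddCommGroup E] [InnerProductSpace ℝ E]
    [CompleteSpace E] (f : E → ℝ) (ξ v : E) : fderiv ℝ f ξ v = inner ℝ (gradient f ξ) v :=
  (InnerProductSpace.toDual_symm_apply (𝕜 := ℝ)).symm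

theorem exists_unit_fderiv_pos {E : Type*} [NormedAddCommGroup E] [InnerProductSpace ℝ E]
    [CompleteSpace E] {f : E → ℝ} {ξ : E} (h : gradient f ξ ≠ 0) :
    ∃ e, ‖e‖ = 1 ∧ 0 < fderiv ℝ f ξ e := by
  have hg : 0 < ‖gradient f ξ‖ := norm_pos_iff.2 h
  refine ⟨‖gradient f ξ‖⁻¹ • gradient f ξ, ?_, ?_⟩
  · rw [norm_smul, norm_inv, norm_norm, inv_mul_cancel₀ hg.ne']
  · rw [fderiv_eq_inner_gradient, inner_smul_right, real_inner_self_eq_norm_sq]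
    positivity

theorem IsPrincipalTerm.differentiableAt {m : ℝ} {am : EuclideanSpace ℝ (Fin n) → ℝ}
    (h : IsPrincipalTerm m am) {ξ : EuclideanSpace ℝ (Fin n)} (hξ : ξ ≠ 0) :
    DifferentiableAt ℝ am ξ :=
  (h.smooth.contDiffAt (isOpen_compl_singleton.mem_nhds hξ)).differentiableAt (by simp)

theorem IsPrincipalTerm.fderiv_smul {m : ℝ} {am : EuclideanSpace ℝ (Fin n) → ℝ}
    (h : IsPrincipalTerm m am) {r : ℝ} (hr : 0 < r) {ζ : EuclideanSpace ℝ (Fin n)} (hζ : ζ ≠ 0) :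
    fderiv ℝ am (r • ζ) = r ^ (m - 1) • fderiv ℝ am ζ := by
  have hrζ : r • ζ ≠ 0 := smul_ne_zero hr.ne' hζ
  have h1 : HasFDerivAt (fun ξ => am (r • ξ)) (r • fderiv ℝ am (r • ζ)) ζ := by
    have h0 := ((r • ContinuousLinearMap.id ℝ (EuclideanSpace ℝ (Fin n))).hasFDerivAt (x := ζ))
    have := (h.differentiableAt hrζ).hasFDerivAt.comp ζ h0
    convert! this using 1
    ext v; simp
  have h2 : HasFDerivAt (fun ξ => am (r • ξ)) (r ^ m • fderiv ℝ am ζ) ζ := by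
    refine ((h.differentiableAt hζ).hasFDerivAt.const_mul (r ^ m)).congr_of_eventuallyEq ?_
    filter_upwards [isOpen_compl_singleton.mem_nhds hζ] with ξ hξ
    exact h.homogeneous r ξ hr hξ
  have h3 := h1.unique h2
  have h4 : fderiv ℝ am (r • ζ) = r⁻¹ • (r ^ m • fderiv ℝ am ζ) := by
    rw [← h3, smul_smul, inv_mul_cancel₀ hr.ne', one_smul]
  rw [h4, smul_smul, Real.rpow_sub_one hr.ne', div_eq_inv_mul]

/-- The derivative is homogeneous of degree `m - 1`, so a bound near `θ`, given by continuity,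
spreads to the cone. The constants do not depend on the truncation height `R`, which can thus be
chosen afterwards. -/
theorem IsPrincipalTerm.exists_cone_fderiv_ge {m : ℝ} (hm : 1 ≤ m)
    {am : EuclideanSpace ℝ (Fin n) → ℝ}
    (h : IsPrincipalTerm m am) {θ : EuclideanSpace ℝ (Fin n)} (hθ : ‖θ‖ = 1)
    (hg : gradient am θ ≠ 0) :
    ∃ e ε c, ‖e‖ = 1 ∧ 0 < ε ∧ 0 < c ∧ ∀ R, 0 ≤ R → ∀ ξ ∈ truncatedCone θ ε R,
      R < 2 * ‖ξ‖ ∧ c * ‖ξ‖ ^ (m - 1) ≤ fderiv ℝ am ξ e := by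
  obtain ⟨e, he, hpos⟩ := exists_unit_fderiv_pos hg
  have hθ0 : θ ≠ 0 := norm_ne_zero_iff.1 (by rw [hθ]; exact one_ne_zero)
  set d := fderiv ℝ am θ e with hd
  have hcont : ContinuousAt (fun ξ => fderiv ℝ am ξ e) θ :=
    ((h.smooth.continuousOn_fderiv_of_isOpen isOpen_compl_singleton (by simp)).continuousAt
      (isOpen_compl_singleton.mem_nhds hθ0)).clm_apply continuousAt_const
  obtain ⟨δ, hδ, hball⟩ := Metric.eventually_nhds_iff.1
    (hcont.eventually (lt_mem_nhds (half_lt_self hpos)))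
  -- The radius `1 / 2` keeps `‖ζ‖` between `1 / 2` and `2`; the factor `2 ^ (m - 1)` then absorbs
  -- `‖ζ‖ ^ (m - 1)`, using `1 ≤ m`.
  refine ⟨e, min δ (1 / 2), d / 2 / 2 ^ (m - 1), he, by positivity, by positivity,
    fun R hR ξ hξ => ?_⟩
  obtain ⟨r, ζ, hr, hζ, rfl⟩ := exists_smul_of_mem_truncatedCone hR hξ
  have hr0 : 0 < r := hR.trans_lt hr
  have hζ1 : ‖ζ - θ‖ < 1 / 2 := hζ.trans_le (min_le_right _ _)
  have hlow : 1 / 2 < ‖ζ‖ := by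
    have := norm_sub_norm_le θ ζ
    rw [norm_sub_rev, hθ] at this
    linarith
  have hup : ‖ζ‖ ≤ 2 := by
    have := norm_sub_norm_le ζ θ
    rw [hθ] at this
    linarith
  have hζ0 : ζ ≠ 0 := norm_pos_iff.1 (by linarith)
  have hnorm : ‖r • ζ‖ = r * ‖ζ‖ := by rw [norm_smul, Real.norm_of_nonneg hr0.le]
  refine ⟨by rw [hnorm]; nlinarith, ?_⟩
  have hlt : d / 2 < fderiv ℝ am ζ e := hball (by
    rw [dist_eq_norm]; exact hζ.trans_le (min_le_left _ _))
  rw [h.fderiv_smul hr0 hζ0, hnorm, Real.mul_rpow hr0.le (norm_nonneg _)]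
  have h2 : ‖ζ‖ ^ (m - 1) ≤ 2 ^ (m - 1) :=
    Real.rpow_le_rpow (norm_nonneg _) hup (by linarith)
  calc d / 2 / 2 ^ (m - 1) * (r ^ (m - 1) * ‖ζ‖ ^ (m - 1))
      ≤ d / 2 / 2 ^ (m - 1) * (r ^ (m - 1) * 2 ^ (m - 1)) := by gcongr
    _ = r ^ (m - 1) * (d / 2) := by
        have : (2 : ℝ) ^ (m - 1) ≠ 0 := by positivity
        field_simp
    _ ≤ r ^ (m - 1) * fderiv ℝ am ζ e := by gcongr
    _ = (r ^ (m - 1) • fderiv ℝ am ζ) e := rfl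

theorem foldr_partialDeriv_single (i : Fin n) (f : EuclideanSpace ℝ (Fin n) → ℝ)
    (l : List (Fin n)) (hl : l.Nodup) :
    l.foldr (fun j g => (partialDeriv j)^[(Pi.single i 1 : Fin n → ℕ) j] g) f =
      if i ∈ l then partialDeriv i f else f := by
  induction l with
  | nil => simp
  | cons j l ih =>
    rw [List.nodup_cons] at hl
    rw [List.foldr_cons, ih hl.2]
    by_cases hij : i = j
    · subst hij
      simp [hl.1]
    · simp [hij]

theorem multiIndexDeriv_single (i : Fin n) (f : EuclideanSpace ℝ (Fin n) → ℝ) :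
    multiIndexDeriv (Pi.single i 1) f = partialDeriv i f := by
  rw [multiIndexDeriv, foldr_partialDeriv_single i f _ (List.nodup_finRange n)]
  simp

theorem fderiv_apply_eq_sum_partialDeriv (f : EuclideanSpace ℝ (Fin n) → ℝ)
    (ξ e : EuclideanSpace ℝ (Fin n)) :
    fderiv ℝ f ξ e = ∑ i, e i * partialDeriv i f ξ := by
  conv_lhs => rw [← (EuclideanSpace.basisFun (Fin n) ℝ).sum_repr e]
  simp [partialDeriv]

/-- Only multi-indices of length one are needed from `lower_order`. -/
theorem DispersiveL.exists_abs_fderiv_sub_le {m : ℝ} {a am : EuclideanSpace ℝ (Fin n) → ℝ}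
    (h : DispersiveL m a am) : ∃ B, 0 ≤ B ∧ ∀ ξ : EuclideanSpace ℝ (Fin n), 1 ≤ ‖ξ‖ → ∀ e, ‖e‖ = 1 →
      |fderiv ℝ (fun η => a η - am η) ξ e| ≤ B * ‖ξ‖ ^ (m - 2) := by
  choose C hC using fun i : Fin n => h.lower_order (Pi.single i 1)
  refine ⟨∑ i, |C i|, Finset.sum_nonneg fun i _ => abs_nonneg _, fun ξ hξ e he => ?_⟩
  rw [fderiv_apply_eq_sum_partialDeriv, Finset.sum_mul]
  refine (Finset.abs_sum_le_sum_abs _ _).trans (Finset.sum_le_sum fun i _ => ?_)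
  have h1 := hC i ξ hξ
  rw [multiIndexDeriv_single, Finset.sum_pi_single'] at h1
  have h2 : |e i| ≤ 1 := by
    have := PiLp.norm_apply_le e i
    rwa [he, Real.norm_eq_abs] at this
  rw [abs_mul]
  calc |e i| * |partialDeriv i (fun η => a η - am η) ξ|
      ≤ 1 * (C i * ‖ξ‖ ^ (m - 2)) := by
        gcongr
        convert! h1 using 3
        simp; ring
    _ ≤ |C i| * ‖ξ‖ ^ (m - 2) := by
        rw [one_mul]; gcongr; exact le_abs_self _

end Derivatives

/-! ### Covering frequency space by transversal regions. -/

section Covering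

variable {n : ℕ} {m s : ℝ} {a am : EuclideanSpace ℝ (Fin n) → ℝ}

theorem hasSmoothing_of_isCompact (ha : Measurable a) {S : Set (EuclideanSpace ℝ (Fin n))}
    (hS : IsCompact S) (h : ∀ ξ ∈ S, ∃ K e c, ξ ∈ K ∧ IsTransversal m a K e c)
    (hs : 1 / 2 < s) : HasSmoothing m s a S := by
  refine hS.induction_on (p := HasSmoothing m s a) hasSmoothing_empty
    (fun _ _ h => HasSmoothing.mono h) (fun _ _ h h' => h.union ha h') fun ξ hξ => ?_
  obtain ⟨K, e, c, hξK, hK⟩ := h ξ hξ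
  exact ⟨K, mem_nhdsWithin_of_mem_nhds (hK.isOpen.mem_nhds hξK), hK.hasSmoothing hs⟩

/-- Transversality on truncated cones in every direction gives the estimate
for high frequencies. -/
theorem hasSmoothing_of_forall_truncatedCone (ha : Measurable a)
    {P : ℝ → Prop} (hP0 : P 0) (hPmax : ∀ R R', P R → P R' → P (max R R'))
    (hP : ∀ R, P R → 0 ≤ R)
    (h : ∀ θ : EuclideanSpace ℝ (Fin n), ‖θ‖ = 1 → ∃ ε R e c, 0 < ε ∧ P R ∧
      IsTransversal m a (truncatedCone θ ε R) e c) (hs : 1 / 2 < s) :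
    ∃ R, P R ∧ HasSmoothing m s a {ξ | R < ‖ξ‖} := by
  have key : ∃ R, P R ∧ HasSmoothing m s a
      {ξ | ∃ r, R < r ∧ ∃ ζ ∈ Metric.sphere (0 : EuclideanSpace ℝ (Fin n)) 1, ξ = r • ζ} := by
    -- `P` records the admissible heights: stability under `max` lets a finite cover share one
    -- height.
    refine (isCompact_sphere (0 : EuclideanSpace ℝ (Fin n)) 1).induction_on
      (p := fun S => ∃ R, P R ∧ HasSmoothing m s a {ξ | ∃ r, R < r ∧ ∃ ζ ∈ S, ξ = r • ζ})
      ⟨0, hP0, by simpa using hasSmoothing_empty⟩ ?_ ?_ ?_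
    · rintro S T hST ⟨R, hR, hT⟩
      refine ⟨R, hR, hT.mono ?_⟩
      rintro ξ ⟨r, hr, ζ, hζ, rfl⟩
      exact ⟨r, hr, ζ, hST hζ, rfl⟩
    · rintro S T ⟨R, hR, hS⟩ ⟨R', hR', hT⟩
      refine ⟨max R R', hPmax R R' hR hR', (hS.union ha hT).mono ?_⟩
      rintro ξ ⟨r, hr, ζ, hζ | hζ, rfl⟩
      · exact Or.inl ⟨r, (le_max_left _ _).trans_lt hr, ζ, hζ, rfl⟩
      · exact Or.inr ⟨r, (le_max_right _ _).trans_lt hr, ζ, hζ, rfl⟩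
    · intro θ hθ
      obtain ⟨ε, R, e, c, hε, hR, hK⟩ := h θ (by simpa using hθ)
      refine ⟨Metric.ball θ ε, mem_nhdsWithin_of_mem_nhds (Metric.ball_mem_nhds θ hε), R, hR,
        (hK.hasSmoothing hs).mono ?_⟩
      rintro ξ ⟨r, hr, ζ, hζ, rfl⟩
      exact smul_mem_truncatedCone (hP R hR) hr (by rwa [← dist_eq_norm])
  obtain ⟨R, hR, hS⟩ := key
  refine ⟨R, hR, hS.mono fun ξ hξ => ?_⟩
  have hpos : 0 < ‖ξ‖ := (hP R hR).trans_lt hξ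
  refine ⟨‖ξ‖, hξ, ‖ξ‖⁻¹ • ξ, ?_, ?_⟩
  · rw [mem_sphere_zero_iff_norm, norm_smul, norm_inv, norm_norm, inv_mul_cancel₀ hpos.ne']
  · rw [smul_smul, mul_inv_cancel₀ hpos.ne', one_smul]

/-- The value of `a` at the origin is arbitrary, so continuity holds only off one point. -/
theorem DispersiveH.measurable (h : DispersiveH a am) (ham : IsPrincipalTerm m am) :
    Measurable a :=
  measurable_of_continuousOn_compl_singleton 0
    (ham.smooth.continuousOn.congr fun ξ hξ => h.eq_principal ξ hξ)

theorem DispersiveH.hasSmoothing (hm : 1 ≤ m) (hs : 1 / 2 < s) (h : DispersiveH a am)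
    (ham : IsPrincipalTerm m am) : HasSmoothing m s a {0}ᶜ := by
  have heq : ∀ ξ, ξ ≠ 0 → a =ᶠ[nhds ξ] am := fun ξ hξ => by
    filter_upwards [isOpen_compl_singleton.mem_nhds hξ] with η hη
    exact h.eq_principal η hη
  -- Admitting only height zero makes the cones reach every nonzero frequency.
  obtain ⟨R, rfl, hR⟩ := hasSmoothing_of_forall_truncatedCone (m := m) (h.measurable ham)
    (P := fun R => R = 0) rfl (by rintro R R' rfl rfl; simp) (fun R hR => hR.ge) (fun θ hθ => by
      have hθ0 : θ ≠ 0 := norm_ne_zero_iff.1 (by rw [hθ]; exact one_ne_zero)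
      obtain ⟨e, ε, c, he, hε, hc, hcone⟩ :=
        ham.exists_cone_fderiv_ge hm hθ (h.gradient_ne_zero θ hθ0)
      have hne : ∀ ξ ∈ truncatedCone θ ε 0, ξ ≠ 0 := fun ξ hξ =>
        norm_pos_iff.1 (by linarith [(hcone 0 le_rfl ξ hξ).1])
      have hfd : ∀ ξ ∈ truncatedCone θ ε 0, c * ‖ξ‖ ^ (m - 1) ≤ fderiv ℝ a ξ e :=
        fun ξ hξ => by
          rw [(heq ξ (hne ξ hξ)).fderiv_eq]
          exact (hcone 0 le_rfl ξ hξ).2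
      refine ⟨ε, 0, e, c, hε, rfl, isOpen_truncatedCone _ _ _, convex_truncatedCone _ _ _, he,
        fun ξ hξ => ?_, fun ξ hξ => ?_, hc, hfd⟩
      · exact (heq ξ (hne ξ hξ)).differentiableAt_iff.2 (ham.differentiableAt (hne ξ hξ))
      · have := norm_pos_iff.2 (hne ξ hξ)
        exact lt_of_lt_of_le (by positivity) (hfd ξ hξ)) hs
  exact hR.mono fun ξ hξ => norm_pos_iff.2 hξ

theorem DispersiveL.exists_isTransversal_ball (hm : 1 ≤ m) (h : DispersiveL m a am)
    (ξ : EuclideanSpace ℝ (Fin n)) : ∃ K e c, ξ ∈ K ∧ IsTransversal m a K e c := by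
  obtain ⟨e, he, hpos⟩ := exists_unit_fderiv_pos (h.gradient_ne_zero ξ)
  set d := fderiv ℝ a ξ e with hd
  have hcont : ContinuousAt (fun ξ => fderiv ℝ a ξ e) ξ :=
    ((h.smooth.continuous_fderiv (by simp)).clm_apply continuous_const).continuousAt
  obtain ⟨δ, hδ, hball⟩ := Metric.eventually_nhds_iff.1
    (hcont.eventually (lt_mem_nhds (half_lt_self hpos)))
  have hlt : ∀ η ∈ Metric.ball ξ (min δ 1), d / 2 < fderiv ℝ a η e := fun η hη =>
    hball (lt_of_lt_of_le hη (min_le_left _ _))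
  refine ⟨Metric.ball ξ (min δ 1), e, d / 2 / (‖ξ‖ + 1) ^ (m - 1),
    Metric.mem_ball_self (by positivity), Metric.isOpen_ball, convex_ball _ _, he,
    -- Positivity is a separate requirement because the ball may contain the origin, where the lower
    -- bound vanishes if `m > 1`.
    fun η _ => h.smooth.differentiable (by simp) η, fun η hη => (half_pos hpos).trans (hlt η hη),
    by positivity, fun η hη => le_trans ?_ (hlt η hη).le⟩
  have hη1 : ‖η‖ ≤ ‖ξ‖ + 1 := by
    have h1 : ‖η - ξ‖ < 1 := by
      rw [← dist_eq_norm]; exact lt_of_lt_of_le hη (min_le_right _ _)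
    have := norm_sub_norm_le η ξ
    linarith
  have h2 : ‖η‖ ^ (m - 1) ≤ (‖ξ‖ + 1) ^ (m - 1) :=
    Real.rpow_le_rpow (norm_nonneg _) hη1 (by linarith)
  have h3 : 0 < (‖ξ‖ + 1) ^ (m - 1) := by positivity
  calc d / 2 / (‖ξ‖ + 1) ^ (m - 1) * ‖η‖ ^ (m - 1)
      ≤ d / 2 / (‖ξ‖ + 1) ^ (m - 1) * (‖ξ‖ + 1) ^ (m - 1) := by gcongr
    _ = d / 2 := by field_simp

theorem DispersiveL.exists_isTransversal_cone (hm : 1 ≤ m) (h : DispersiveL m a am)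
    (ham : IsPrincipalTerm m am) {θ : EuclideanSpace ℝ (Fin n)} (hθ : ‖θ‖ = 1) :
    ∃ ε R e c, 0 < ε ∧ 0 ≤ R ∧ IsTransversal m a (truncatedCone θ ε R) e c := by
  have hθ0 : θ ≠ 0 := norm_ne_zero_iff.1 (by rw [hθ]; exact one_ne_zero)
  obtain ⟨e, ε, c, he, hε, hc, hcone⟩ :=
    ham.exists_cone_fderiv_ge hm hθ (h.gradient_principal_ne_zero θ hθ0)
  obtain ⟨B, hB0, hB⟩ := h.exists_abs_fderiv_sub_le
  -- Points of the cone satisfy `R < 2 * ‖ξ‖`. So `2` gives `1 ≤ ‖ξ‖`, and `4 * B / c` makes the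
  -- lower-order derivative at most half of the principal bound.
  set R := max 2 (4 * B / c) with hR
  have hR0 : 0 ≤ R := le_trans (by norm_num) (le_max_left _ _)
  have h1 : ∀ ξ ∈ truncatedCone θ ε R, 1 ≤ ‖ξ‖ := fun ξ hξ => by
    linarith [(hcone R hR0 ξ hξ).1, le_max_left 2 (4 * B / c)]
  have hd : Differentiable ℝ a := h.smooth.differentiable (by simp)
  have hfd : ∀ ξ ∈ truncatedCone θ ε R, c / 2 * ‖ξ‖ ^ (m - 1) ≤ fderiv ℝ a ξ e := by
    intro ξ hξ
    obtain ⟨hξR, hlow⟩ := hcone R hR0 ξ hξ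
    have hpos : 0 < ‖ξ‖ := by linarith [h1 ξ hξ]
    have hsub : fderiv ℝ (fun η => a η - am η) ξ e = fderiv ℝ a ξ e - fderiv ℝ am ξ e := by
      rw [fderiv_fun_sub (hd ξ) (ham.differentiableAt (norm_pos_iff.1 hpos))]
      rfl
    have hup := abs_le.1 (hB ξ (h1 ξ hξ) e he)
    have hBc : B ≤ c / 2 * ‖ξ‖ := by
      have : 4 * B / c < 2 * ‖ξ‖ := (le_max_right _ _).trans_lt hξR
      rw [div_lt_iff₀ hc] at this
      linarith
    have hpow : ‖ξ‖ ^ (m - 1) = ‖ξ‖ * ‖ξ‖ ^ (m - 2) := by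
      rw [show m - 1 = 1 + (m - 2) by ring, Real.rpow_add hpos, Real.rpow_one]
    have hmul : B * ‖ξ‖ ^ (m - 2) ≤ c / 2 * ‖ξ‖ ^ (m - 1) := by
      rw [hpow, ← mul_assoc]
      gcongr
    linarith [hup.1]
  refine ⟨ε, R, e, c / 2, hε, hR0, isOpen_truncatedCone _ _ _, convex_truncatedCone _ _ _, he,
    fun ξ _ => hd ξ, fun ξ hξ => ?_, half_pos hc, hfd⟩
  have hpos : 0 < ‖ξ‖ := by linarith [h1 ξ hξ]
  exact lt_of_lt_of_le (by positivity) (hfd ξ hξ)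

theorem DispersiveL.hasSmoothing (hm : 1 ≤ m) (hs : 1 / 2 < s) (h : DispersiveL m a am)
    (ham : IsPrincipalTerm m am) : HasSmoothing m s a {0}ᶜ := by
  have hmeas : Measurable a := h.smooth.continuous.measurable
  obtain ⟨R, -, hR⟩ := hasSmoothing_of_forall_truncatedCone (m := m) hmeas
    (P := fun R => 0 ≤ R) le_rfl (fun R R' hR _ => le_max_of_le_left hR) (fun R hR => hR)
    (fun θ hθ => h.exists_isTransversal_cone hm ham hθ) hs
  have hball := hasSmoothing_of_isCompact hmeas
    (isCompact_closedBall (0 : EuclideanSpace ℝ (Fin n)) R)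
    (fun ξ _ => h.exists_isTransversal_ball hm ξ) hs
  refine (hR.union hmeas hball).mono fun ξ _ => ?_
  rcases lt_or_ge R ‖ξ‖ with h | h
  · exact Or.inl h
  · exact Or.inr (by simpa using h)

end Covering

/-! ### Limits in `L²` and on time slices. -/

section Limits

theorem tendsto_integral_mul_of_tendsto_eLpNorm_two {α : Type*} [MeasurableSpace α]
    {μ : Measure α} {F : ℕ → α → ℂ} {f h : α → ℂ} (hF : ∀ k, MemLp (F k) 2 μ) (hf : MemLp f 2 μ)
    (hh : MemLp h 2 μ) (hlim : Filter.Tendsto (fun k => eLpNorm (F k - f) 2 μ) Filter.atTop (nhds 0)) :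
    Filter.Tendsto (fun k => ∫ x, F k x * h x ∂μ) Filter.atTop (nhds (∫ x, f x * h x ∂μ)) := by
  have hintg : ∀ g : α → ℂ, MemLp g 2 μ → Integrable (fun x => g x * h x) μ := fun g hg =>
    memLp_one_iff_integrable.1 (MemLp.mul' (p := 2) (q := 2) hh hg)
  refine tendsto_integral_of_L1' _ (hintg f hf).1
    (Filter.Eventually.of_forall fun k => hintg _ (hF k)) ?_
  have hle : ∀ k, eLpNorm ((fun x => F k x * h x) - fun x => f x * h x) 1 μ ≤
      eLpNorm (F k - f) 2 μ * eLpNorm h 2 μ := by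
    intro k
    have := eLpNorm_smul_le_mul_eLpNorm (p := 2) (q := 2) (r := 1) hh.1 ((hF k).sub hf).1
    refine le_trans (le_of_eq ?_) this
    congr 1
    ext x; simp [sub_mul]
  refine tendsto_of_tendsto_of_tendsto_of_le_of_le tendsto_const_nhds ?_ (fun _ => zero_le) hle
  simpa using ENNReal.Tendsto.mul_const hlim (Or.inr hh.eLpNorm_ne_top)

/-- A Schwartz function times a measurable function of polynomial growth is in `L²`. -/
theorem SchwartzMap.memLp_two_mul_of_growth {n : ℕ} (ψ : 𝓢(EuclideanSpace ℝ (Fin n), ℂ))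
    {g : EuclideanSpace ℝ (Fin n) → ℂ} (hg : Measurable g) {C q : ℝ}
    (hgC : ∀ x, ‖g x‖ ≤ C * (1 + ‖x‖ ^ 2) ^ q) : MemLp (fun x => g x * ψ x) 2 := by
  obtain ⟨N, hN⟩ := exists_nat_ge q
  have hT : (fun x : EuclideanSpace ℝ (Fin n) => (1 + ‖x‖ ^ 2) ^ N).HasTemperateGrowth :=
    ((Function.HasTemperateGrowth.const 1).add
      (Function.hasTemperateGrowth_norm_sq (EuclideanSpace ℝ (Fin n)))).pow N
  have h1 := (SchwartzMap.smulLeftCLM ℂ (fun x : EuclideanSpace ℝ (Fin n) => (1 + ‖x‖ ^ 2) ^ N)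
    ψ).memLp 2
  refine h1.of_le_mul (c := C) (hg.aestronglyMeasurable.mul ψ.continuous.aestronglyMeasurable)
    (Filter.Eventually.of_forall fun x => ?_)
  have hx : 1 ≤ 1 + ‖x‖ ^ 2 := by nlinarith [sq_nonneg ‖x‖]
  rw [SchwartzMap.smulLeftCLM_apply_apply hT, norm_smul, norm_mul,
    Real.norm_of_nonneg (by positivity), ← mul_assoc]
  have hC : 0 ≤ C := by
    have h := (norm_nonneg _).trans (hgC x)
    exact nonneg_of_mul_nonneg_left h (by positivity)
  gcongr
  refine (hgC x).trans ?_
  gcongr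
  rw [← Real.rpow_natCast (1 + ‖x‖ ^ 2) N]
  exact Real.rpow_le_rpow_of_exponent_le hx hN

theorem MeasureTheory.MemLp.ae_memLp_prodMk {α β : Type*} [MeasurableSpace α] [MeasurableSpace β]
    {μ : Measure α} {ν : Measure β} [SFinite μ] [SFinite ν] {F : α × β → ℂ}
    (hF : MemLp F 2 (μ.prod ν)) : ∀ᵐ t ∂μ, MemLp (fun x => F (t, x)) 2 ν := by
  have hlt : ∫⁻ t, ∫⁻ x, ‖F (t, x)‖ₑ ^ 2 ∂ν ∂μ < ⊤ := by
    rw [← lintegral_prod _ (hF.1.enorm.pow_const 2), ← eLpNorm_two_sq]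
    exact ENNReal.pow_lt_top hF.2
  filter_upwards [hF.1.prodMk_left, ae_lt_top' (hF.1.enorm.pow_const 2).lintegral_prod_right'
    hlt.ne] with t h1 h2
  refine ⟨h1, ?_⟩
  rw [← eLpNorm_two_sq] at h2
  exact (ENNReal.pow_lt_top_iff.1 h2).resolve_right two_ne_zero

/-- `L²` convergence on a product gives, for almost every slice, `L²` convergence
along a subsequence. -/
theorem ae_exists_subseq_tendsto_eLpNorm_two {α β : Type*} [MeasurableSpace α] [MeasurableSpace β]
    {μ : Measure α} {ν : Measure β} [SFinite μ] [SFinite ν] {F : ℕ → α × β → ℂ}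
    {G : α × β → ℂ} (hF : ∀ k, MemLp (F k) 2 (μ.prod ν)) (hG : MemLp G 2 (μ.prod ν))
    (hlim : Filter.Tendsto (fun k => eLpNorm (F k - G) 2 (μ.prod ν)) Filter.atTop (nhds 0)) :
    ∀ᵐ t ∂μ, ∃ κ : ℕ → ℕ, StrictMono κ ∧ Filter.Tendsto
      (fun j => eLpNorm ((fun x => F (κ j) (t, x)) - fun x => G (t, x)) 2 ν)
      Filter.atTop (nhds 0) := by
  set D : ℕ → α → ℝ≥0∞ := fun k t => ∫⁻ x, ‖(F k - G) (t, x)‖ₑ ^ 2 ∂ν with hD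
  have hm : ∀ k, AEMeasurable (fun p => ‖(F k - G) p‖ₑ ^ 2) (μ.prod ν) := fun k =>
    ((hF k).sub hG).1.enorm.pow_const 2
  have hDm : ∀ k, AEMeasurable (D k) μ := fun k => (hm k).lintegral_prod_right'
  have hintg : ∀ k, ∫⁻ t, D k t ∂μ = eLpNorm (F k - G) 2 (μ.prod ν) ^ 2 := fun k => by
    rw [eLpNorm_two_sq, lintegral_prod _ (hm k)]
  -- By Fatou the slice distances have zero `liminf` for almost every `t`; the extracted subsequence
  -- may depend on `t`.
  have hzero : ∫⁻ t, Filter.liminf (fun k => D k t) Filter.atTop ∂μ = 0 := by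
    refine le_antisymm ((lintegral_liminf_le' hDm).trans ?_) (zero_le)
    simp only [hintg]
    have : Filter.Tendsto (fun k => eLpNorm (F k - G) 2 (μ.prod ν) ^ 2) Filter.atTop (nhds 0) := by
      simpa using ENNReal.Tendsto.pow (n := 2) hlim
    exact this.liminf_eq.le
  have hmlim : AEMeasurable (fun t => Filter.liminf (fun k => D k t) Filter.atTop) μ := by
    refine ⟨fun t => Filter.liminf (fun k => (hDm k).mk (D k) t) Filter.atTop,
      Measurable.liminf fun k => (hDm k).measurable_mk, ?_⟩
    filter_upwards [ae_all_iff.2 fun k => (hDm k).ae_eq_mk] with t ht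
    simp only [ht]
  filter_upwards [(lintegral_eq_zero_iff' hmlim).1 hzero] with t ht
  have hfreq : ∀ j : ℕ, ∃ᶠ k in Filter.atTop, D k t < ((j : ℝ≥0∞) + 1)⁻¹ := fun j =>
    Filter.frequently_lt_of_liminf_lt (h := by
      rw [ht]
      simp only [Pi.zero_apply]
      exact ENNReal.inv_pos.2 (by finiteness))
  obtain ⟨κ, hκ, hlt⟩ := Filter.extraction_forall_of_frequently hfreq
  refine ⟨κ, hκ, ?_⟩
  have hsq : Filter.Tendsto (fun j => D (κ j) t) Filter.atTop (nhds 0) := by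
    refine tendsto_of_tendsto_of_tendsto_of_le_of_le tendsto_const_nhds ?_ (fun _ => zero_le)
      (fun j => (hlt j).le)
    have := (Filter.tendsto_add_atTop_iff_nat 1).2 ENNReal.tendsto_inv_nat_nhds_zero
    simpa using this
  have hroot := (ENNReal.continuous_rpow_const (y := (1 / 2 : ℝ))).tendsto 0 |>.comp hsq
  have h0 : (0 : ℝ≥0∞) ^ (1 / 2 : ℝ) = 0 := ENNReal.zero_rpow_of_pos (by norm_num)
  rw [h0] at hroot
  refine hroot.congr fun j => ?_
  have h1 : D (κ j) t =
      eLpNorm ((fun x => F (κ j) (t, x)) - fun x => G (t, x)) 2 ν ^ 2 := by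
    rw [eLpNorm_two_sq]; rfl
  rw [Function.comp_apply, h1, ← ENNReal.rpow_natCast, ← ENNReal.rpow_mul]
  norm_num

/-- A sequence dominated in `L²` by a convergent sequence converges in `L²`. -/
theorem exists_tendsto_eLpNorm_two_of_le {α β : Type*} [MeasurableSpace α] [MeasurableSpace β]
    {μ : Measure α} {ν : Measure β} {F : ℕ → α → ℂ} {f : ℕ → β → ℂ} {f' : β → ℂ} {C : NNReal}
    (hF : ∀ k, MemLp (F k) 2 μ) (hf : ∀ k, MemLp (f k) 2 ν) (hf' : MemLp f' 2 ν)
    (hle : ∀ k l, eLpNorm (F k - F l) 2 μ ≤ C * eLpNorm (f k - f l) 2 ν)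
    (hlim : Filter.Tendsto (fun k => eLpNorm (f k - f') 2 ν) Filter.atTop (nhds 0)) :
    ∃ G : α → ℂ, MemLp G 2 μ ∧
      Filter.Tendsto (fun k => eLpNorm (F k - G) 2 μ) Filter.atTop (nhds 0) := by
  have hconv : Filter.Tendsto (fun k => (hf k).toLp) Filter.atTop (nhds (hf'.toLp)) :=
    (Lp.tendsto_Lp_iff_tendsto_eLpNorm'' _ hf _ hf').2 hlim
  have hlip : ∀ k l, edist (hF k).toLp (hF l).toLp ≤ C * edist (hf k).toLp (hf l).toLp := by
    intro k l
    rw [Lp.edist_toLp_toLp, Lp.edist_toLp_toLp]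
    exact hle k l
  have hcau : CauchySeq fun k => (hF k).toLp := by
    have hc := hconv.cauchySeq
    rw [EMetric.cauchySeq_iff] at hc ⊢
    intro ε hε
    -- `C + 1` avoids division by zero when `C = 0`.
    obtain ⟨N, hN⟩ := hc (ε / (C + 1)) (ENNReal.div_pos hε.ne' (by finiteness))
    refine ⟨N, fun k hk l hl => ?_⟩
    by_cases hε' : ε = ⊤
    · rw [hε']; exact edist_lt_top _ _
    calc edist (hF k).toLp (hF l).toLp ≤ C * edist (hf k).toLp (hf l).toLp := hlip k l
      _ ≤ (C + 1) * edist (hf k).toLp (hf l).toLp := by gcongr; exact le_self_add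
      _ < (C + 1) * (ε / (C + 1)) :=
          ENNReal.mul_lt_mul_right (by simp) (by finiteness) (hN k hk l hl)
      _ ≤ ε := ENNReal.mul_div_le
  obtain ⟨G, hG⟩ := cauchySeq_tendsto_of_complete hcau
  refine ⟨G, Lp.memLp G, ?_⟩
  have := (Lp.tendsto_Lp_iff_tendsto_eLpNorm' _ _).1 hG
  refine this.congr fun k => eLpNorm_congr_ae ?_
  filter_upwards [(hF k).coeFn_toLp] with x hx
  simp [hx]

end Limits

/-! ### Passage to arbitrary data in `L²`. -/

section Conclusion

variable {n : ℕ} {m s : ℝ} {a : EuclideanSpace ℝ (Fin n) → ℝ}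

/-- Restriction of a function to the punctured ball of radius `k`. -/
noncomputable def truncate (f : EuclideanSpace ℝ (Fin n) → ℂ) (k : ℕ) :
    EuclideanSpace ℝ (Fin n) → ℂ :=
  (Metric.closedBall 0 (k : ℝ) \ {0}).indicator f

theorem measurableSet_puncturedBall (k : ℕ) :
    MeasurableSet (Metric.closedBall (0 : EuclideanSpace ℝ (Fin n)) (k : ℝ) \ {0}) :=
  Metric.isClosed_closedBall.measurableSet.diff (measurableSet_singleton 0)

theorem memLp_truncate {f : EuclideanSpace ℝ (Fin n) → ℂ} (hf : MemLp f 2) (k : ℕ) :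
    MemLp (truncate f k) 2 :=
  hf.indicator (measurableSet_puncturedBall k)

theorem integrable_weight_mul_truncate (hm : 1 ≤ m) {f : EuclideanSpace ℝ (Fin n) → ℂ}
    (hf : MemLp f 2) (k : ℕ) :
    Integrable (fun ξ => ((‖(2 * Real.pi) • ξ‖ ^ ((m - 1) / 2) : ℝ) : ℂ) * truncate f k ξ) := by
  have hB := measurableSet_puncturedBall (n := n) k
  have hfin : volume (Metric.closedBall (0 : EuclideanSpace ℝ (Fin n)) (k : ℝ) \ {0}) < ⊤ :=
    (measure_mono Set.sdiff_subset).trans_lt measure_closedBall_lt_top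
  have : IsFiniteMeasure
      (volume.restrict (Metric.closedBall (0 : EuclideanSpace ℝ (Fin n)) (k : ℝ) \ {0})) :=
    isFiniteMeasure_restrict.2 hfin.ne
  have h1 : IntegrableOn f (Metric.closedBall (0 : EuclideanSpace ℝ (Fin n)) (k : ℝ) \ {0}) :=
    (hf.restrict _).integrable (by norm_num)
  have hmeas : Measurable fun ξ : EuclideanSpace ℝ (Fin n) =>
      ((‖(2 * Real.pi) • ξ‖ ^ ((m - 1) / 2) : ℝ) : ℂ) := by fun_prop
  have h2 := h1.bdd_mul (c := (2 * Real.pi * k) ^ ((m - 1) / 2)) hmeas.aestronglyMeasurable (by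
    filter_upwards [ae_restrict_mem hB] with ξ hξ
    have hξk : ‖ξ‖ ≤ k := by simpa using hξ.1
    rw [Complex.norm_real, Real.norm_of_nonneg (by positivity), norm_smul,
      Real.norm_of_nonneg (by positivity)]
    exact Real.rpow_le_rpow (by positivity) (by gcongr) (by linarith))
  refine ((integrable_indicator_iff hB).2 h2).congr (Filter.Eventually.of_forall fun ξ => ?_)
  by_cases h : ξ ∈ Metric.closedBall (0 : EuclideanSpace ℝ (Fin n)) (k : ℝ) \ {0}
  · simp only [truncate, Set.indicator_of_mem h]
  · simp only [truncate, Set.indicator_of_notMem h, mul_zero]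

/-- Dominated convergence; `1 ≤ n` makes the removed origin a null set. -/
theorem tendsto_eLpNorm_truncate_sub (hn : 1 ≤ n) {f : EuclideanSpace ℝ (Fin n) → ℂ}
    (hf : MemLp f 2) :
    Filter.Tendsto (fun k => eLpNorm (truncate f k - f) 2 volume) Filter.atTop (nhds 0) := by
  have : Nonempty (Fin n) := ⟨⟨0, hn⟩⟩
  have hae : ∀ᵐ ξ : EuclideanSpace ℝ (Fin n), ξ ≠ 0 := by
    simp [ae_iff]
  have hsq : Filter.Tendsto (fun k => ∫⁻ ξ, ‖(truncate f k - f) ξ‖ₑ ^ 2) Filter.atTop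
      (nhds (∫⁻ _ : EuclideanSpace ℝ (Fin n), 0)) := by
    refine tendsto_lintegral_of_dominated_convergence' (fun ξ => ‖f ξ‖ₑ ^ 2)
      (fun k => ((memLp_truncate hf k).sub hf).1.enorm.pow_const 2)
      (fun k => Filter.Eventually.of_forall fun ξ => ?_) ?_ ?_
    · by_cases h : ξ ∈ Metric.closedBall (0 : EuclideanSpace ℝ (Fin n)) (k : ℝ) \ {0}
      · simp [truncate, Set.indicator_of_mem h]
      · simp [truncate, Set.indicator_of_notMem h]
    · rw [← eLpNorm_two_sq]
      exact ENNReal.pow_ne_top hf.eLpNorm_ne_top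
    · filter_upwards [hae] with ξ hξ
      refine tendsto_const_nhds.congr' ?_
      obtain ⟨N, hN⟩ := exists_nat_ge ‖ξ‖
      filter_upwards [Filter.eventually_ge_atTop N] with k hk
      have h : ξ ∈ Metric.closedBall (0 : EuclideanSpace ℝ (Fin n)) (k : ℝ) \ {0} :=
        ⟨by simpa using hN.trans (by exact_mod_cast hk), hξ⟩
      simp [truncate, Set.indicator_of_mem h]
  rw [lintegral_zero] at hsq
  have hroot := (ENNReal.continuous_rpow_const (y := (1 / 2 : ℝ))).tendsto 0 |>.comp hsq
  have h0 : (0 : ℝ≥0∞) ^ (1 / 2 : ℝ) = 0 := ENNReal.zero_rpow_of_pos (by norm_num)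
  rw [h0] at hroot
  refine hroot.congr fun k => ?_
  rw [Function.comp_apply, ← eLpNorm_two_sq, ← ENNReal.rpow_natCast, ← ENNReal.rpow_mul]
  norm_num

theorem memLp_japaneseBracket_rpow_mul (s : ℝ) (ψ : 𝓢(EuclideanSpace ℝ (Fin n), ℂ)) :
    MemLp (fun x => ((japaneseBracket x ^ s : ℝ) : ℂ) * ψ x) 2 := by
  have := measurable_japaneseBracket (n := n)
  refine ψ.memLp_two_mul_of_growth (C := 1) (q := s / 2) (by fun_prop) fun x => ?_
  rw [Complex.norm_real, Real.norm_of_nonneg (Real.rpow_nonneg (japaneseBracket_pos _).le _),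
    japaneseBracket, Real.sqrt_eq_rpow, ← Real.rpow_mul (by positivity), one_mul]
  exact le_of_eq (by congr 1; ring)

theorem memLp_smoothingSymbol_mul (hm : 1 ≤ m) (ha : Measurable a) (t : ℝ)
    (ψ : 𝓢(EuclideanSpace ℝ (Fin n), ℂ)) :
    MemLp (fun ξ => smoothingSymbol m a t ((2 * Real.pi) • ξ) * ψ ξ) 2 := by
  refine ψ.memLp_two_mul_of_growth (C := (2 * Real.pi) ^ ((m - 1) / 2)) (q := (m - 1) / 2)
    (by unfold smoothingSymbol; fun_prop) fun ξ => ?_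
  rw [smoothingSymbol, norm_mul, norm_exp_I_mul_mul, mul_one, Complex.norm_real,
    Real.norm_of_nonneg (by positivity), norm_smul, Real.norm_of_nonneg (by positivity),
    Real.mul_rpow (by positivity) (by positivity)]
  gcongr
  nlinarith [sq_nonneg (‖ξ‖ - 1)]

theorem integral_evolve_mul (ha : Measurable a) {f : EuclideanSpace ℝ (Fin n) → ℂ}
    (hf : Integrable (fun ξ => ((‖(2 * Real.pi) • ξ‖ ^ ((m - 1) / 2) : ℝ) : ℂ) * f ξ)) (t : ℝ)
    (ψ : 𝓢(EuclideanSpace ℝ (Fin n), ℂ)) :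
    ∫ x, evolve m a f (t, x) * ψ x =
      ∫ ξ, f ξ * (smoothingSymbol m a t ((2 * Real.pi) • ξ) * (𝓕⁻ ψ) ξ) := by
  have h := integral_fourierInv_mul_eq (integrable_smoothingSymbol_mul ha hf t) ψ.integrable
  refine h.trans (integral_congr_ae (Filter.Eventually.of_forall fun ξ => ?_))
  simp only [SchwartzMap.fourierInv_coe]
  ring

theorem japaneseBracket_rpow_mul_rpow_neg (s : ℝ) (x : EuclideanSpace ℝ (Fin n)) :
    ((japaneseBracket x ^ s : ℝ) : ℂ) * ((japaneseBracket x ^ (-s) : ℝ) : ℂ) = 1 := by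
  rw [← Complex.ofReal_mul, ← Real.rpow_add (japaneseBracket_pos x)]
  simp

theorem HasSmoothing.exists_estimate (hn : 1 ≤ n) (hm : 1 ≤ m) (ha : Measurable a)
    (h : HasSmoothing m s a {0}ᶜ) : ∃ C : ℝ, 0 < C ∧
      ∀ φ : Lp ℂ 2 (volume : Measure (EuclideanSpace ℝ (Fin n))),
        ∃ u : ℝ × EuclideanSpace ℝ (Fin n) → ℂ,
          AEStronglyMeasurable u volume ∧
          (∀ᵐ t : ℝ, IsFourierMultiplierApplied (smoothingSymbol m a t) φ (fun x => u (t, x))) ∧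
          eLpNorm (fun p : ℝ × EuclideanSpace ℝ (Fin n) =>
              ((japaneseBracket p.2 ^ (-s) : ℝ) : ℂ) * u p) 2 volume
            ≤ ENNReal.ofReal (C * ‖φ‖) := by
  obtain ⟨S', hS', -, C, hC⟩ := h
  refine ⟨C + 1, by positivity, fun φ => ?_⟩
  set f : EuclideanSpace ℝ (Fin n) → ℂ :=
    ⇑(𝓕 φ : Lp ℂ 2 (volume : Measure (EuclideanSpace ℝ (Fin n)))) with hfdef
  have hf : MemLp f 2 := Lp.memLp _
  have hfnorm : eLpNorm f 2 volume = ENNReal.ofReal ‖φ‖ := by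
    rw [hfdef, ← Lp.enorm_def, ← ofReal_norm, Lp.norm_fourier_eq]
  have htr := memLp_truncate hf
  have hintg := integrable_weight_mul_truncate hm hf
  have hlim := tendsto_eLpNorm_truncate_sub hn hf
  -- The set `S'` may omit the origin, which is why `truncate` removes it.
  have htr0 : ∀ k ξ, (2 * Real.pi) • ξ ∉ S' → truncate f k ξ = 0 := by
    intro k ξ hξ
    have h0 : ξ = 0 := by
      by_contra hne
      exact hξ (hS' (smul_ne_zero (by positivity) hne))
    simp [truncate, h0]
  set F : ℕ → ℝ × EuclideanSpace ℝ (Fin n) → ℂ := fun k p =>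
    ((japaneseBracket p.2 ^ (-s) : ℝ) : ℂ) * evolve m a (truncate f k) p with hF
  have hFle : ∀ k, eLpNorm (F k) 2 volume ≤ C * eLpNorm (truncate f k) 2 volume := fun k =>
    hC _ (htr k).1 (hintg k) (htr0 k)
  have hFm : ∀ k, MemLp (F k) 2 volume := fun k =>
    ⟨aestronglyMeasurable_weight_mul_evolve ha (htr k).1,
      (hFle k).trans_lt (ENNReal.mul_lt_top ENNReal.coe_lt_top (htr k).2)⟩
  -- By linearity the estimate applies to differences, so the weighted solutions inherit the Cauchy
  -- property.
  have hdiff : ∀ k l, eLpNorm (F k - F l) 2 volume ≤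
      C * eLpNorm (truncate f k - truncate f l) 2 volume := by
    intro k l
    have hsub : F k - F l = fun p => ((japaneseBracket p.2 ^ (-s) : ℝ) : ℂ) *
        evolve m a (truncate f k - truncate f l) p := by
      ext p
      rw [evolve_sub ha (hintg k) (hintg l), mul_sub]
      rfl
    rw [hsub]
    refine hC _ ((htr k).sub (htr l)).1 ?_ fun ξ hξ => by simp [htr0 k ξ hξ, htr0 l ξ hξ]
    simpa only [Pi.sub_apply, mul_sub] using! (hintg k).sub (hintg l)
  obtain ⟨G, hG, hGlim⟩ := exists_tendsto_eLpNorm_two_of_le hFm htr hf hdiff hlim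
  have hbracket : Measurable (japaneseBracket : EuclideanSpace ℝ (Fin n) → ℝ) :=
    measurable_japaneseBracket
  have hbracket' : Measurable fun p : ℝ × EuclideanSpace ℝ (Fin n) =>
      ((japaneseBracket p.2 ^ s : ℝ) : ℂ) := by fun_prop
  -- The limit `G` is that of the weighted solutions, so `u` is obtained by removing the weight.
  refine ⟨fun p => ((japaneseBracket p.2 ^ s : ℝ) : ℂ) * G p,
    hbracket'.aestronglyMeasurable.mul hG.1, ?_, ?_⟩
  · have hsub := ae_exists_subseq_tendsto_eLpNorm_two (μ := (volume : Measure ℝ))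
      (ν := (volume : Measure (EuclideanSpace ℝ (Fin n)))) hFm hG hGlim
    filter_upwards [hsub, ae_all_iff.2 fun k => MemLp.ae_memLp_prodMk (hFm k),
      MemLp.ae_memLp_prodMk hG] with t ht hFt hGt ψ
    obtain ⟨κ, hκ, hκlim⟩ := ht
    have hψ := memLp_japaneseBracket_rpow_mul s ψ
    have hσ := memLp_smoothingSymbol_mul hm ha t (𝓕⁻ ψ)
    have hu : ∀ x, ((japaneseBracket x ^ s : ℝ) : ℂ) * G (t, x) * ψ x =
        G (t, x) * (((japaneseBracket x ^ s : ℝ) : ℂ) * ψ x) := fun x => by ring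
    have hv : ∀ ξ, smoothingSymbol m a t ((2 * Real.pi) • ξ) * f ξ * (𝓕⁻ ψ) ξ =
        f ξ * (smoothingSymbol m a t ((2 * Real.pi) • ξ) * (𝓕⁻ ψ) ξ) := fun ξ => by ring
    change Integrable (fun x => ((japaneseBracket x ^ s : ℝ) : ℂ) * G (t, x) * ψ x) ∧
      Integrable (fun ξ => smoothingSymbol m a t ((2 * Real.pi) • ξ) * f ξ * (𝓕⁻ ψ) ξ) ∧
      ∫ x, ((japaneseBracket x ^ s : ℝ) : ℂ) * G (t, x) * ψ x =
        ∫ ξ, smoothingSymbol m a t ((2 * Real.pi) • ξ) * f ξ * (𝓕⁻ ψ) ξ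
    simp only [hu, hv]
    refine ⟨memLp_one_iff_integrable.1 (MemLp.mul' (p := 2) (q := 2) hψ hGt),
      memLp_one_iff_integrable.1 (MemLp.mul' (p := 2) (q := 2) hσ hf), ?_⟩
    -- For truncated data the distributional identity is `integral_evolve_mul`. Both sides converge
    -- along `κ`, the weight being moved onto `ψ` on the left and the symbol onto `𝓕⁻ ψ` on the
    -- right.
    have hlim1 := tendsto_integral_mul_of_tendsto_eLpNorm_two (fun j => hFt (κ j)) hGt hψ hκlim
    have hlim2 := tendsto_integral_mul_of_tendsto_eLpNorm_two (fun j => htr (κ j)) hf hσ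
      (hlim.comp hκ.tendsto_atTop)
    refine tendsto_nhds_unique (hlim1.congr fun j => ?_) hlim2
    rw [← integral_evolve_mul ha (hintg (κ j)) t ψ]
    refine integral_congr_ae (Filter.Eventually.of_forall fun x => ?_)
    simp only [hF]
    linear_combination (evolve m a (truncate f (κ j)) (t, x) * ψ x) *
      japaneseBracket_rpow_mul_rpow_neg s x
  · have hw : (fun p : ℝ × EuclideanSpace ℝ (Fin n) => ((japaneseBracket p.2 ^ (-s) : ℝ) : ℂ) *
        (((japaneseBracket p.2 ^ s : ℝ) : ℂ) * G p)) = G := by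
      ext p
      linear_combination G p * japaneseBracket_rpow_mul_rpow_neg s p.2
    rw [hw]
    have hbound : ∀ k, eLpNorm G 2 volume ≤ eLpNorm (F k - G) 2 volume + C * eLpNorm f 2 volume := by
      intro k
      calc eLpNorm G 2 volume = eLpNorm (F k - (F k - G)) 2 volume := by rw [sub_sub_cancel]
        _ ≤ eLpNorm (F k) 2 volume + eLpNorm (F k - G) 2 volume :=
            eLpNorm_sub_le (hFm k).1 ((hFm k).sub hG).1 (by norm_num)
        _ ≤ C * eLpNorm f 2 volume + eLpNorm (F k - G) 2 volume := by
            gcongr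
            refine (hFle k).trans ?_
            gcongr
            exact eLpNorm_indicator_le f
        _ = _ := add_comm _ _
    have hle := ge_of_tendsto' (hGlim.add_const (C * eLpNorm f 2 volume)) hbound
    rw [zero_add, hfnorm] at hle
    refine hle.trans ?_
    rw [ENNReal.ofReal_mul (by positivity)]
    gcongr
    rw [← ENNReal.ofReal_coe_nnreal]
    exact ENNReal.ofReal_le_ofReal (by linarith)

end Conclusion

/-- For every `φ ∈ L²(ℝⁿ)` there is a measurable function `u` on `ℝ_t × ℝⁿ_x` which, for almost
every `t`, represents the tempered distribution `|D_x|^{(m-1)/2} e^{i t a(D_x)} φ`, and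
`‖⟨x⟩^{-s} u‖_{L²(ℝ_t × ℝⁿ_x)} ≤ C ‖φ‖_{L²(ℝⁿ)}` with `C` independent of `φ`. -/
theorem theorem4p1 (n : ℕ) (hn : 1 ≤ n) (m s : ℝ) (hm : 1 ≤ m) (hs : 1 / 2 < s)
    (a am : EuclideanSpace ℝ (Fin n) → ℝ) (ham : IsPrincipalTerm m am)
    (ha : DispersiveH a am ∨ DispersiveL m a am) :
    ∃ C : ℝ, 0 < C ∧
      ∀ φ : Lp ℂ 2 (volume : Measure (EuclideanSpace ℝ (Fin n))),
        ∃ u : ℝ × EuclideanSpace ℝ (Fin n) → ℂ,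
          AEStronglyMeasurable u volume ∧
          (∀ᵐ t : ℝ, IsFourierMultiplierApplied (smoothingSymbol m a t) φ (fun x => u (t, x))) ∧
          eLpNorm (fun p : ℝ × EuclideanSpace ℝ (Fin n) =>
              ((japaneseBracket p.2 ^ (-s) : ℝ) : ℂ) * u p) 2 volume
            ≤ ENNReal.ofReal (C * ‖φ‖) := by
  rcases ha with h | h
  · exact (h.hasSmoothing hm hs ham).exists_estimate hn hm (h.measurable ham)
  · exact (h.hasSmoothing hm hs ham).exists_estimate hn hm h.smooth.continuous.measurable
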